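/- For $n\in\mathbb N$ let $$I_{n,n+1}=\{f\in C([0,1],M_n\otimes M_{n+1}) : f(0)\in M_n\otimes 1,\ f(1)\in 1\otimes M_{n+1}\}$$ be the dimension drop algebra (matrix algebras over $\mathbb C$). Write $\mathbb C^n\otimes\mathbb C^{n+1}=(\mathbb C^n\otimes\mathbb C^n)\oplus\mathbb C^n$, let $F$ be the self-adjoint unitary that flips the tensor factors of $\mathbb C^n\otimes\mathbb C^n$ and is the identity on the second summand, and for $t\in[0,1]$ put $u_t=\frac{1+e^{i\pi t}}2\,1+\frac{1-e^{i\pi t}}2\,F$, a path of unitaries from $1$ to $F$. Regard $M_n$ as embedded in $I_{n,n+1}$ by the completely positive contractive order zero map $$\iota\colon M_n\to I_{n,n+1},\qquad \iota(x)(t)=u_t^*\bigl(x\otimes\operatorname{diag}(1,\dots,1,1-t)\bigr)u_t ,$$ and for a unit vector $h\in\mathbb C^n$ let $s_h\in I_{n,n+1}$ be $s_h(t)=\sqrt t\;u_t^*\bigl(\sum_{i=1}^n h e_i^*\otimes e_i e_{n+1}^*\bigr)u_t$, where $(e_i)$ are the standard basis vectors. **Theorem.** Let $G$ be a finite group, let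 $B$ be a unital $C^*$-algebra and let $\beta\colon G\to\operatorname{Aut}(B)$ be an action. Let $n\in\mathbb N$, let $v\colon G\to U(n)$ be a unitary representation containing the trivial representation, and let $e_{1,1}\in M_n$ be a rank-one projection onto a line of $v$-fixed vectors, that is, $v_g e_{1,1}=e_{1,1}$ for all $g\in G$. Suppose that $\xi\colon (M_n,\operatorname{Ad}(v))\to(B,\beta)$ is a completely positive contractive equivariant map of order zero (that is, $\xi(a)\xi(b)=0$ whenever $a,b\ge 0$ and $ab=0$), and that $s\in B$ is a contraction fixed by $\beta$ with $\xi(e_{1,1})s=s$ and $\xi(1)+s^*s=1$. Let $\gamma$ be the restriction to $I_{n,n+1}$ of the action $\mathrm{id}_{C([0,1])}\otimes\operatorname{Ad}(v)\otimes\operatorname{Ad}(v\oplus 1_{\mathbb C})$ of $G$ on $C([0,1])\otimes M_n\otimes M_{n+1}$. Then $\xi$ extends to a unital equivariant homomorphism $\pi\colon(I_{n,n+1},\gamma)\to(B,\beta)$, that is, $\pi\circ\iota=\xi$; moreover, $\pi$ can be chosen so that $\pi(s_h)=s$ for some unit vector $h$ with $e_{1,1}=hh^*$. -/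

import Mathlib

open scoped ComplexOrder

namespace DimDrop

/-- The C*-algebra of complex square matrices with rows and columns indexed by `ι`, with the
operator norm and its C*-algebraic order. For `ι = Fin n` this is `M_n`. -/
abbrev Mat (ι : Type*) := CStarMatrix ι ι ℂ

section Matrices

set_option linter.unusedSectionVars false

variable {ι κ : Type*} [Fintype ι] [DecidableEq ι] [Fintype κ] [DecidableEq κ]

/-- The elementary tensor `a ⊗ b` in `M_ι ⊗ M_κ = M_{ι × κ}` (Kronecker product). -/
def kron (a : Mat ι) (b : Mat κ) : Mat (ι × κ) :=
  CStarMatrix.ofMatrix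
    (Matrix.kronecker (CStarMatrix.ofMatrix.symm a) (CStarMatrix.ofMatrix.symm b))

/-- The block diagonal matrix `a ⊕ b`. -/
def directSum (a : Mat ι) (b : Mat κ) : Mat (ι ⊕ κ) :=
  CStarMatrix.ofMatrix
    (Matrix.fromBlocks (CStarMatrix.ofMatrix.symm a) 0 0 (CStarMatrix.ofMatrix.symm b))

theorem kron_apply (a : Mat ι) (b : Mat κ) (p q : ι × κ) :
    kron a b p q = a p.1 q.1 * b p.2 q.2 := rfl

theorem kron_mul (a a' : Mat ι) (b b' : Mat κ) :
    kron a b * kron a' b' = kron (a * a') (b * b') :=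
  (Matrix.mul_kronecker_mul (CStarMatrix.ofMatrix.symm a) (CStarMatrix.ofMatrix.symm a')
    (CStarMatrix.ofMatrix.symm b) (CStarMatrix.ofMatrix.symm b')).symm

theorem kron_one : kron (1 : Mat ι) (1 : Mat κ) = 1 :=
  Matrix.one_kronecker_one

theorem kron_star (a : Mat ι) (b : Mat κ) : star (kron a b) = kron (star a) (star b) := by
  ext p q
  simp [kron_apply, CStarMatrix.star_apply]

theorem kron_add_left (a a' : Mat ι) (b : Mat κ) :
    kron (a + a') b = kron a b + kron a' b := by
  ext p q
  simp [kron_apply, CStarMatrix.add_apply, add_mul]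

theorem kron_add_right (a : Mat ι) (b b' : Mat κ) :
    kron a (b + b') = kron a b + kron a b' := by
  ext p q
  simp [kron_apply, CStarMatrix.add_apply, mul_add]

theorem kron_smul_left (c : ℂ) (a : Mat ι) (b : Mat κ) : kron (c • a) b = c • kron a b := by
  ext p q
  simp [kron_apply, CStarMatrix.smul_apply, mul_assoc]

theorem kron_smul_right (c : ℂ) (a : Mat ι) (b : Mat κ) : kron a (c • b) = c • kron a b := by
  ext p q
  simp [kron_apply, CStarMatrix.smul_apply, mul_left_comm]

theorem directSum_mul (a a' : Mat ι) (b b' : Mat κ) :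
    directSum a b * directSum a' b' = directSum (a * a') (b * b') := by
  refine (Matrix.fromBlocks_multiply _ _ _ _ _ _ _ _).trans ?_
  simp only [Matrix.mul_zero, Matrix.zero_mul, add_zero, zero_add]
  rfl

theorem directSum_one : directSum (1 : Mat ι) (1 : Mat κ) = 1 :=
  Matrix.fromBlocks_one

theorem directSum_star (a : Mat ι) (b : Mat κ) :
    star (directSum a b) = directSum (star a) (star b) := by
  refine (Matrix.fromBlocks_conjTranspose _ _ _ _).trans ?_
  simp only [Matrix.conjTranspose_zero]
  rfl

end Matrices

section Algebra

variable (ι κ : Type*) [Fintype ι] [DecidableEq ι] [Fintype κ] [DecidableEq κ]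

/-- The dimension drop algebra
`{f ∈ C([0,1], M_ι ⊗ M_κ) : f(0) ∈ M_ι ⊗ 1, f(1) ∈ 1 ⊗ M_κ}`.
For index sets with `m` and `n` elements this is `I_{m,n}`. -/
def dimDrop : StarSubalgebra ℂ C(unitInterval, Mat (ι × κ)) where
  carrier := {f | (∃ a : Mat ι, f 0 = kron a 1) ∧ ∃ b : Mat κ, f 1 = kron 1 b}
  mul_mem' := by
    rintro f g ⟨⟨a, ha⟩, b, hb⟩ ⟨⟨a', ha'⟩, b', hb'⟩
    exact ⟨⟨a * a', by rw [ContinuousMap.mul_apply, ha, ha', kron_mul, mul_one]⟩,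
      b * b', by rw [ContinuousMap.mul_apply, hb, hb', kron_mul, mul_one]⟩
  add_mem' := by
    rintro f g ⟨⟨a, ha⟩, b, hb⟩ ⟨⟨a', ha'⟩, b', hb'⟩
    exact ⟨⟨a + a', by rw [ContinuousMap.add_apply, ha, ha', kron_add_left]⟩,
      b + b', by rw [ContinuousMap.add_apply, hb, hb', kron_add_right]⟩
  algebraMap_mem' := by
    intro r
    refine ⟨⟨r • 1, ?_⟩, r • 1, ?_⟩
    · rw [kron_smul_left, kron_one, Algebra.algebraMap_eq_smul_one]; rfl
    · rw [kron_smul_right, kron_one, Algebra.algebraMap_eq_smul_one]; rfl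
  star_mem' := by
    rintro f ⟨⟨a, ha⟩, b, hb⟩
    exact ⟨⟨star a, by rw [ContinuousMap.star_apply, ha, kron_star, star_one]⟩,
      star b, by rw [ContinuousMap.star_apply, hb, kron_star, star_one]⟩

end Algebra

section Actions

variable {ι κ : Type*} [Fintype ι] [DecidableEq ι] [Fintype κ] [DecidableEq κ]
variable {G : Type*} [Group G]

/-- The direct sum `v ⊕ w` of two unitary representations. -/
def sumRep (v : G →* unitary (Mat ι)) (w : G →* unitary (Mat κ)) :
    G →* unitary (Mat (ι ⊕ κ)) where
  toFun g := ⟨directSum (v g : Mat ι) (w g : Mat κ), by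
    rw [Unitary.mem_iff, directSum_star, directSum_mul, directSum_mul]
    simp [directSum_one]⟩
  map_one' := Subtype.ext (by simp [directSum_one])
  map_mul' g h := Subtype.ext (by simp [directSum_mul])

/-- The tensor product `v ⊗ w` of two unitary representations. -/
def tensorRep (v : G →* unitary (Mat ι)) (w : G →* unitary (Mat κ)) :
    G →* unitary (Mat (ι × κ)) where
  toFun g := ⟨kron (v g : Mat ι) (w g : Mat κ), by
    rw [Unitary.mem_iff, kron_star, kron_mul, kron_mul]
    simp [kron_one]⟩
  map_one' := Subtype.ext (by simp [kron_one])
  map_mul' g h := Subtype.ext (by simp [kron_mul])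

/-- The action `Ad v` of `G` on a matrix algebra: `Ad(v)_g (x) = v_g x v_g^*`. -/
noncomputable def Ad (v : G →* unitary (Mat ι)) : G →* (Mat ι ≃⋆ₐ[ℂ] Mat ι) :=
  (Unitary.conjStarAlgAut ℂ (Mat ι)).comp v

theorem Ad_apply (v : G →* unitary (Mat ι)) (g : G) (x : Mat ι) :
    Ad v g x = (v g : Mat ι) * x * star (v g : Mat ι) := rfl

/-- `Ad(v ⊗ w) = Ad(v) ⊗ Ad(w)`. -/
theorem Ad_tensorRep (v : G →* unitary (Mat ι)) (w : G →* unitary (Mat κ)) (g : G)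
    (a : Mat ι) (b : Mat κ) :
    Ad (tensorRep v w) g (kron a b) = kron (Ad v g a) (Ad w g b) := by
  simp only [Ad_apply, tensorRep, MonoidHom.coe_mk, OneHom.coe_mk, kron_star, kron_mul]

/-- The pointwise action of `Ad(v) ⊗ Ad(w)` on the dimension drop algebra. -/
noncomputable def dimDropHom (v : G →* unitary (Mat ι)) (w : G →* unitary (Mat κ)) (g : G)
    (f : dimDrop ι κ) : dimDrop ι κ :=
  ⟨⟨fun t => Ad (tensorRep v w) g ((f : C(unitInterval, Mat (ι × κ))) t), by
      simp only [Ad_apply]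
      fun_prop⟩, by
    obtain ⟨f, ⟨a, ha⟩, b, hb⟩ := f
    refine ⟨⟨Ad v g a, ?_⟩, Ad w g b, ?_⟩
    · rw [ContinuousMap.coe_mk, ha, Ad_tensorRep, map_one]
    · rw [ContinuousMap.coe_mk, hb, Ad_tensorRep, map_one]⟩

theorem dimDropHom_apply (v : G →* unitary (Mat ι)) (w : G →* unitary (Mat κ)) (g : G)
    (f : dimDrop ι κ) (t : unitInterval) :
    (dimDropHom v w g f : C(unitInterval, Mat (ι × κ))) t =
      Ad (tensorRep v w) g ((f : C(unitInterval, Mat (ι × κ))) t) := rfl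

/-- The action `γ_{v,w}` of `G` on the dimension drop algebra: the restriction of
`id ⊗ Ad(v) ⊗ Ad(w)` on `C([0,1]) ⊗ M_ι ⊗ M_κ`. -/
noncomputable def dimDropAction (v : G →* unitary (Mat ι)) (w : G →* unitary (Mat κ)) :
    G →* (dimDrop ι κ ≃⋆ₐ[ℂ] dimDrop ι κ) where
  toFun g :=
    { toFun := dimDropHom v w g
      invFun := dimDropHom v w g⁻¹
      left_inv := fun f => by
        refine Subtype.ext (ContinuousMap.ext fun t => ?_)
        rw [dimDropHom_apply, dimDropHom_apply, ← StarAlgEquiv.mul_apply, ← map_mul]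
        simp
      right_inv := fun f => by
        refine Subtype.ext (ContinuousMap.ext fun t => ?_)
        rw [dimDropHom_apply, dimDropHom_apply, ← StarAlgEquiv.mul_apply, ← map_mul]
        simp
      map_mul' := fun f f' => Subtype.ext (ContinuousMap.ext fun t =>
        map_mul (Ad (tensorRep v w) g) ((f : C(unitInterval, Mat (ι × κ))) t)
          ((f' : C(unitInterval, Mat (ι × κ))) t))
      map_add' := fun f f' => Subtype.ext (ContinuousMap.ext fun t =>
        map_add (Ad (tensorRep v w) g) ((f : C(unitInterval, Mat (ι × κ))) t)
          ((f' : C(unitInterval, Mat (ι × κ))) t))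
      map_star' := fun f => Subtype.ext (ContinuousMap.ext fun t =>
        map_star (Ad (tensorRep v w) g) ((f : C(unitInterval, Mat (ι × κ))) t))
      map_smul' := fun c f => Subtype.ext (ContinuousMap.ext fun t =>
        map_smul (Ad (tensorRep v w) g) c ((f : C(unitInterval, Mat (ι × κ))) t)) }
  map_one' := by
    refine StarAlgEquiv.ext fun f => Subtype.ext (ContinuousMap.ext fun t => ?_)
    change Ad (tensorRep v w) 1 _ = _
    rw [map_one]; rfl
  map_mul' g h := by
    refine StarAlgEquiv.ext fun f => Subtype.ext (ContinuousMap.ext fun t => ?_)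
    change Ad (tensorRep v w) (g * h) _ = _
    rw [map_mul]; rfl

end Actions

section Embedding

variable (n : ℕ)

/-- An index set with `n + 1` elements, split as `n + 1`; `Mat (Succ n)` is `M_{n+1}`. -/
abbrev Succ (n : ℕ) := Fin n ⊕ Fin 1

/-- The rank-one projection `0 ⊕ 1` in `M_{n+1}` onto the last coordinate. -/
def lastProj : Mat (Succ n) := directSum 0 1

/-- The partial tensor flip on `ℂ^n ⊗ (ℂ^n ⊕ ℂ) = (ℂ^n ⊗ ℂ^n) ⊕ ℂ^n`: the self-adjoint unitary
that maps `e_i ⊗ e_j` to `e_j ⊗ e_i` for `i, j ≤ n` and fixes `e_i ⊗ e_{n+1}`. -/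
def flip : Mat (Fin n × Succ n) := fun p q =>
  match p, q with
  | (i, Sum.inl j), (k, Sum.inl l) => if i = l ∧ j = k then 1 else 0
  | (i, Sum.inr _), (k, Sum.inr _) => if i = k then 1 else 0
  | _, _ => 0

/-- The unitary path `u_t = (1 + e^{iπt})/2 + (1 - e^{iπt})/2 · flip`, from `u_0 = 1` to
`u_1 = flip`. It commutes with `w ⊗ (w ⊕ 1)` for every unitary `w` of `M_n`. -/
noncomputable def flipPath (t : unitInterval) : Mat (Fin n × Succ n) :=
  ((1 + Complex.exp (Real.pi * (t : ℝ) * Complex.I)) / 2) • (1 : Mat (Fin n × Succ n)) +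
    ((1 - Complex.exp (Real.pi * (t : ℝ) * Complex.I)) / 2) • flip n

theorem flipPath_zero : flipPath n 0 = 1 := by
  simp [flipPath]

theorem flipPath_one : flipPath n 1 = flip n := by
  simp [flipPath]

theorem continuous_flipPath : Continuous (flipPath n) := by
  unfold flipPath
  fun_prop

theorem flip_star : star (flip n) = flip n := by
  ext ⟨i, j⟩ ⟨k, l⟩
  rw [CStarMatrix.star_apply]
  rcases j with j | j <;> rcases l with l | l <;> simp [flip, and_comm, eq_comm]

variable {n}

theorem flip_mul (A : Mat (Fin n × Succ n)) (i : Fin n) (j : Succ n) (q : Fin n × Succ n) :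
    (flip n * A) (i, j) q = A (Sum.elim (fun k => (k, Sum.inl i)) (fun k => (i, Sum.inr k)) j) q := by
  rw [CStarMatrix.mul_apply]
  rcases j with j | j
  · rw [Finset.sum_eq_single (j, Sum.inl i)]
    · simp [flip]
    · rintro ⟨k, l⟩ - h
      rcases l with l | l
      · have : ¬ (i = l ∧ j = k) := by rintro ⟨rfl, rfl⟩; exact h rfl
        simp [flip, this]
      · simp [flip]
    · simp
  · rw [Finset.sum_eq_single (i, Sum.inr j)]
    · simp [flip]
    · rintro ⟨k, l⟩ - h
      rcases l with l | l
      · simp [flip]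
      · have : ¬ (i = k) := by
          rintro rfl; exact h (by rw [Subsingleton.elim l j])
        simp [flip, this]
    · simp

theorem mul_flip (A : Mat (Fin n × Succ n)) (i : Fin n) (j : Succ n) (q : Fin n × Succ n) :
    (A * flip n) q (i, j) = A q (Sum.elim (fun k => (k, Sum.inl i)) (fun k => (i, Sum.inr k)) j) := by
  have h := flip_mul (star A) i j q
  rw [← flip_star, ← star_mul, CStarMatrix.star_apply, CStarMatrix.star_apply] at h
  exact star_injective h

/-- The canonical completely positive contractive order zero embedding of `M_n` into `I_{n,n+1}`,
`x ↦ (t ↦ u_t^* (x ⊗ diag(1, …, 1, 1 - t)) u_t)`; it takes the value `x ⊗ 1` at `t = 0` and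
`1 ⊗ (x ⊕ 0)` at `t = 1`. -/
noncomputable def embed (x : Mat (Fin n)) : dimDrop (Fin n) (Succ n) :=
  ⟨⟨fun t => star (flipPath n t) * kron x (1 - ((t : ℝ) : ℂ) • lastProj n) * flipPath n t, by
      have h := continuous_flipPath n
      simp only [sub_eq_add_neg, ← neg_smul, kron_add_right, kron_smul_right]
      fun_prop⟩, by
    refine ⟨⟨x, ?_⟩, directSum x 0, ?_⟩
    · rw [ContinuousMap.coe_mk, flipPath_zero, star_one, one_mul, mul_one, Set.Icc.coe_zero,
        Complex.ofReal_zero, zero_smul ℂ, sub_zero]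
    · rw [ContinuousMap.coe_mk, flipPath_one, flip_star]
      ext ⟨i, j⟩ ⟨k, l⟩
      rw [mul_flip, flip_mul]
      rcases j with j | j <;> rcases l with l | l <;>
        simp [kron_apply, lastProj, directSum, CStarMatrix.one_apply, CStarMatrix.sub_apply,
          mul_comm, Subsingleton.elim _ (0 : Fin 1)]⟩

/-- For `h ∈ ℂ^n`, the matrix `∑_i (h e_i^*) ⊗ (e_i e_{n+1}^*)` in `M_n ⊗ M_{n+1}`. -/
def cornerMat (h : Fin n → ℂ) : Mat (Fin n × Succ n) := fun p q =>
  match p, q with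
  | (i, Sum.inl j), (k, Sum.inr _) => if j = k then h i else 0
  | _, _ => 0

/-- The matrix `h e_{n+1}^*` in `M_{n+1}`. -/
def lastCol (h : Fin n → ℂ) : Mat (Succ n) := fun p q =>
  match p, q with
  | Sum.inl i, Sum.inr _ => h i
  | _, _ => 0

/-- The canonical element `t ↦ √t · u_t^* (∑_i (h e_i^*) ⊗ (e_i e_{n+1}^*)) u_t` of `I_{n,n+1}`;
it takes the value `0` at `t = 0` and `1 ⊗ (h e_{n+1}^*)` at `t = 1`. -/
noncomputable def corner (h : Fin n → ℂ) : dimDrop (Fin n) (Succ n) :=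
  ⟨⟨fun t => ((Real.sqrt (t : ℝ) : ℝ) : ℂ) •
      (star (flipPath n t) * cornerMat h * flipPath n t), by
      have h := continuous_flipPath n
      fun_prop⟩, by
    refine ⟨⟨0, ?_⟩, lastCol h, ?_⟩
    · rw [ContinuousMap.coe_mk, Set.Icc.coe_zero, Real.sqrt_zero, Complex.ofReal_zero,
        zero_smul ℂ]
      ext p q
      simp [kron_apply]
    · rw [ContinuousMap.coe_mk, flipPath_one, flip_star]
      ext ⟨i, j⟩ ⟨k, l⟩
      rw [CStarMatrix.smul_apply, mul_flip, flip_mul]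
      rcases j with j | j <;> rcases l with l | l <;>
        simp [kron_apply, cornerMat, lastCol, CStarMatrix.one_apply]⟩

end Embedding

/-- A map between ordered algebras has *order zero* if it sends orthogonal positive elements to
orthogonal elements. -/
def IsOrderZero {A B : Type*} [Mul A] [Zero A] [Preorder A] [Mul B] [Zero B] (φ : A → B) : Prop :=
  ∀ a b : A, 0 ≤ a → 0 ≤ b → a * b = 0 → φ a * φ b = 0

end DimDrop

namespace DimDrop

open Polynomial

/-! ### Order zero maps: moving a projection across a product -/

section OrderZero

variable {B : Type*} [CStarAlgebra B] [PartialOrder B] [StarOrderedRing B]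

/-! The dimension drop algebra has a presentation by generators and relations, and `ξ` together with
`s` satisfies the relations. Complete positivity and order zero give `ξ(a) ξ(b) = ξ(1) ξ(ab)`
(`IsOrderZero.map_mul_map`). Write `e = h h^*` and put `Y_i = ξ(e_i h^*) s` for `i ≤ n` and `Y_{n+1}
= |s|`. Then `Y_k^* Y_l = δ_{kl} (1 - ξ(1))`, the `Y_i` with `i ≤ n` transform under `ξ(a)` like
basis vectors, and `Y_{n+1}` commutes with `ξ(a)`. These are the relations of `WeightedUnits`; the
pair `embed`, `corner h` gives a second instance, `model`, inside the dimension drop algebra.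

By the relations alone, the elements `ξ(a)`, `H_{kl} = Y_k Y_l^*` and `p(z) Y_k ξ(a) Y_l^*`, with `z
= ∑ Y_k Y_k^*` and `p` a polynomial, span a unital `*`-algebra (`gens_mul_gens`). In the model,
after undoing the conjugation by `u_t`, `z` is the function `t`, the third family consists of the
matrix units of `M_n ⊗ M_{n+1}` times `t (1 - t) p(t)`, and `ξ(a)` and `H_{kl}` account for the
boundary values at `0` and `1`. Weierstrass approximation makes this algebra dense
(`denseRange_model_param`). Sending a combination in the model to the same combination in `B` is
bounded: the coefficients are controlled by the model norm (`norm_param_coeff_le`), and they control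
the norm in `B` because `‖p(z) Y_k ξ(e_{ij}) Y_l^*‖ ≤ sup |t (1 - t) p(t)|` (`norm_aeval_mul_W_le`).
The extension by continuity is `π`.

The span contains the products `Y_k Y_l^*` but need not contain the `Y_k`, so `π(s_h) = s` takes a
further argument: first `π(|s_h|) = |s|` by uniqueness of positive square roots, then `s` is
recovered from `s |s|` and `s^* s`. For equivariance, `β_g⁻¹ ∘ π ∘ γ_g` agrees with `π` on the
weighted units, since `h` is fixed by `v`, hence on a dense subalgebra. -/

theorem exists_eq_star_mul_self {D : Type*} [NonUnitalCStarAlgebra D] [PartialOrder D]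
    [StarOrderedRing D] {a : D} (ha : 0 ≤ a) : ∃ b, a = star b * b :=
  CStarAlgebra.nonneg_iff_eq_star_mul_self.mp ha

theorem eq_zero_of_sum_star_mul_self_eq_zero {k : Type*} [Fintype k] (x : k → B)
    (h : ∑ i, star (x i) * x i = 0) (i : k) : x i = 0 := by
  rw [Finset.sum_eq_zero_iff_of_nonneg fun i _ => star_mul_self_nonneg (x i)] at h
  exact CStarRing.star_mul_self_eq_zero_iff _ |>.mp (h i (Finset.mem_univ i))

/-- In a positive block matrix, an element annihilated by a diagonal entry is annihilated by the
whole column of that entry. -/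
theorem entry_mul_eq_zero_of_nonneg {k : Type*} [Fintype k] {N : CStarMatrix k k B} (hN : 0 ≤ N)
    {i j : k} {y : B} (h : N i i * y = 0) : N j i * y = 0 := by
  classical
  obtain ⟨S, rfl⟩ := exists_eq_star_mul_self hN
  simp only [CStarMatrix.mul_apply, CStarMatrix.star_apply] at h ⊢
  have h0 : ∑ l, star (S l i * y) * (S l i * y) = 0 := by
    have := congrArg (fun x => star y * x) h
    simpa [Finset.sum_mul, Finset.mul_sum, mul_assoc] using this
  rw [Finset.sum_mul]
  refine Finset.sum_eq_zero fun l _ => ?_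
  rw [mul_assoc, eq_zero_of_sum_star_mul_self_eq_zero _ h0 l, mul_zero]

variable {A : Type*} [CStarAlgebra A] [PartialOrder A] [StarOrderedRing A]

/-- This is 2-positivity applied to the Gram matrix of the row `(a, b)`: its image is a positive
block matrix whose first column consists of `ξ(a^* a)` and `ξ(b^* a)`. -/
theorem map_mul_eq_zero_of_star_mul_self (ξ : CompletelyPositiveMap A B)
    (a b : A) {y : B} (h : ξ (star a * a) * y = 0) : ξ (star b * a) * y = 0 := by
  let R : CStarMatrix (Fin 2) (Fin 2) A :=
    CStarMatrix.ofMatrix !![a, b; 0, 0]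
  have hR : 0 ≤ (star R * R).map ξ := ξ.map_cstarMatrix_nonneg' 2 _ (star_mul_self_nonneg R)
  have e : ∀ i j, (star R * R).map ξ i j = ξ (star (R 0 i) * R 0 j) := by
    intro i j
    have : R 1 i = 0 := by fin_cases i <;> rfl
    simp [CStarMatrix.mul_apply, CStarMatrix.star_apply, Fin.sum_univ_two, this]
  have := entry_mul_eq_zero_of_nonneg hR (i := 0) (j := 1) (y := y) (by rw [e]; exact h)
  rw [e] at this
  exact this

theorem completelyPositive_map_star (ξ : CompletelyPositiveMap A B) (a : A) :
    ξ (star a) = star (ξ a) := by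
  have h : ∀ x : A, 0 ≤ x → star (ξ x) = ξ x := fun x hx =>
    (IsSelfAdjoint.of_nonneg (map_nonneg ξ hx)).star_eq
  have hs : ∀ x : A, IsSelfAdjoint x → star (ξ x) = ξ x := by
    intro x hx
    rw [← CFC.posPart_sub_negPart x hx, map_sub, star_sub, h _ (CFC.posPart_nonneg x),
      h _ (CFC.negPart_nonneg x)]
  conv_rhs => rw [← realPart_add_I_smul_imaginaryPart a]
  conv_lhs => rw [← realPart_add_I_smul_imaginaryPart a]
  simp only [star_add, star_smul, map_add, map_smul, selfAdjoint.star_val_eq,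
    hs _ (realPart a).2, hs _ (imaginaryPart a).2]

/-- Both sides equal `ξ(a p) ξ(p b)`, because the cross terms with `1 - p` vanish. The order zero
hypothesis only gives `ξ(q) ξ(p) = 0` for orthogonal projections; 2-positivity, used once on each
side, inserts the factors `a` and `b`. -/
theorem IsOrderZero.map_mul_proj {ξ : CompletelyPositiveMap A B} (hξ : IsOrderZero ξ)
    {p : A} (hp : IsStarProjection p) (a b : A) : ξ (a * p) * ξ b = ξ a * ξ (p * b) := by
  have key : ∀ {p q : A}, IsStarProjection p → IsStarProjection q → p * q = 0 → ∀ a b : A,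
      ξ (a * p) * ξ (q * b) = 0 := by
    intro p q hp hq hpq a b
    have h1 : ξ q * ξ p = 0 := by
      refine hξ q p hq.nonneg hp.nonneg ?_
      have := congrArg star hpq
      rwa [star_mul, star_zero, hp.isSelfAdjoint.star_eq, hq.isSelfAdjoint.star_eq] at this
    have h2 : ξ (star b * q) * ξ p = 0 := by
      have := map_mul_eq_zero_of_star_mul_self ξ q b (y := ξ p)
      rw [hq.isSelfAdjoint.star_eq, hq.isIdempotentElem] at this
      exact this h1
    have h3 : ξ p * ξ (q * b) = 0 := by
      have := congrArg star h2
      rwa [star_mul, ← completelyPositive_map_star, ← completelyPositive_map_star, star_mul,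
        star_star, star_zero, hp.isSelfAdjoint.star_eq, hq.isSelfAdjoint.star_eq] at this
    have := map_mul_eq_zero_of_star_mul_self ξ p (star a) (y := ξ (q * b))
    rw [hp.isSelfAdjoint.star_eq, hp.isIdempotentElem, star_star] at this
    exact this h3
  have e1 := key hp hp.one_sub (by rw [mul_sub, mul_one, hp.isIdempotentElem, sub_self]) a b
  have e2 := key hp.one_sub hp (by rw [sub_mul, one_mul, hp.isIdempotentElem, sub_self]) a b
  rw [sub_mul, one_mul, map_sub, mul_sub, sub_eq_zero] at e1
  rw [mul_sub, mul_one, map_sub, sub_mul, sub_eq_zero] at e2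
  rw [e1, e2]

end OrderZero

/-! ### Matrix units and the product formula for order zero maps -/

section Mat

set_option linter.unusedSectionVars false

variable {ι : Type*} [Fintype ι] [DecidableEq ι]

/-- The matrix unit `e_{ij}`. -/
def unit (i j : ι) : Mat ι := CStarMatrix.ofMatrix (Matrix.single i j 1)

theorem unit_apply (i j k l : ι) : unit i j k l = if i = k ∧ j = l then 1 else 0 := rfl

theorem eq_sum_unit (a : Mat ι) : a = ∑ i, ∑ j, a i j • unit i j := by
  have := Matrix.matrix_eq_sum_single (CStarMatrix.ofMatrix.symm a)
  refine this.trans ?_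
  refine Finset.sum_congr rfl fun i _ => Finset.sum_congr rfl fun j _ => ?_
  have h := Matrix.smul_single (a i j) i j (1 : ℂ)
  rw [smul_eq_mul, mul_one] at h
  exact h.symm

theorem unit_mul_unit (i j k l : ι) : unit i j * unit k l = if j = k then unit i l else 0 := by
  split_ifs with h
  · subst h
    have := Matrix.single_mul_single_same (1 : ℂ) i j l 1
    rw [mul_one] at this
    exact this
  · exact Matrix.single_mul_single_of_ne (1 : ℂ) i j k h 1

theorem unit_star (i j : ι) : star (unit i j) = unit j i := by
  ext k l
  simp only [CStarMatrix.star_apply, unit_apply, and_comm]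
  split_ifs <;> simp

variable {B : Type*} [CStarAlgebra B] [PartialOrder B] [StarOrderedRing B]

/-- A completely positive order zero map on a matrix algebra satisfies
`ξ(a) ξ(b) = ξ(1) ξ(a b)`. -/
theorem IsOrderZero.map_mul_map {ξ : CompletelyPositiveMap (Mat ι) B} (hξ : IsOrderZero ξ)
    (a b : Mat ι) : ξ a * ξ b = ξ 1 * ξ (a * b) := by
  suffices h : ∀ x a b : Mat ι, ξ (a * x) * ξ b = ξ a * ξ (x * b) by
    simpa using h a 1 b
  -- The `x` that can be moved across the product form a subspace closed under multiplication and
  -- containing all projections, hence contain every matrix unit: `e_{ij} = 2 e_{ii} P e_{jj}` for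
  -- the projection `P` onto the line of `e_i + e_j`.
  have hmul : ∀ x y : Mat ι, (∀ a b : Mat ι, ξ (a * x) * ξ b = ξ a * ξ (x * b)) →
      (∀ a b : Mat ι, ξ (a * y) * ξ b = ξ a * ξ (y * b)) →
      ∀ a b : Mat ι, ξ (a * (x * y)) * ξ b = ξ a * ξ (x * y * b) := by
    intro x y hx hy a b
    rw [← mul_assoc, hy, hx, mul_assoc]
  have hproj : ∀ i : ι, IsStarProjection (unit i i) := fun i =>
    ⟨isIdempotentElem_iff.mpr ((unit_mul_unit i i i i).trans (if_pos rfl)), unit_star i i⟩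
  have hunit : ∀ i j : ι, ∀ a b : Mat ι, ξ (a * unit i j) * ξ b = ξ a * ξ (unit i j * b) := by
    intro i j
    by_cases hij : i = j
    · subst hij
      exact fun a b => hξ.map_mul_proj (hproj i) a b
    have hP : IsStarProjection ((1 / 2 : ℂ) • (unit i i + unit j j + unit i j + unit j i)) := by
      constructor
      · refine isIdempotentElem_iff.mpr ?_
        simp only [smul_mul_smul_comm, add_mul, mul_add, unit_mul_unit,
          hij, Ne.symm hij, if_true, if_false]
        module
      · change star _ = _
        simp only [star_smul, star_add, unit_star]
        rw [show star (1 / 2 : ℂ) = 1 / 2 by simp]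
        abel_nf
    have hs : ((1 / 2 : ℂ) • (unit i i + unit j j + unit i j + unit j i)) * unit j j =
        (1 / 2 : ℂ) • (unit i j + unit j j) := by
      simp only [smul_mul_assoc, add_mul, unit_mul_unit, hij, if_true, if_false]
      module
    have he : unit i i * (((1 / 2 : ℂ) • (unit i i + unit j j + unit i j + unit j i)) * unit j j) =
        (1 / 2 : ℂ) • unit i j := by
      rw [hs]
      simp only [mul_smul_comm, mul_add, unit_mul_unit, hij, if_true, if_false]
      module
    intro a b
    have := hmul _ _ (fun a b => hξ.map_mul_proj (hproj i) a b)
      (hmul _ _ (fun a b => hξ.map_mul_proj hP a b) fun a b => hξ.map_mul_proj (hproj j) a b) a b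
    rw [he, mul_smul_comm, smul_mul_assoc, map_smul, map_smul, smul_mul_assoc, mul_smul_comm] at this
    exact smul_right_injective B (by norm_num : (1 / 2 : ℂ) ≠ 0) this
  intro x a b
  rw [eq_sum_unit x]
  simp only [Finset.mul_sum, Finset.sum_mul, map_sum, mul_smul_comm, smul_mul_assoc, map_smul,
    hunit]

end Mat

/-! ### Weighted units and the `*`-algebra they span -/

/-- The last index of `Succ n`. -/
abbrev lastIdx (n : ℕ) : Succ n := Sum.inr 0

/-- An order zero map `ξ` on `M_n` together with elements `Y_k` that behave like the weighted
matrix units `√t · e_{k,n+1}` of the dimension drop algebra `I_{n,n+1}`. -/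
structure WeightedUnits (n : ℕ) (D : Type*) [Ring D] [StarRing D] [Algebra ℂ D] where
  /-- The order zero map. -/
  ξ : Mat (Fin n) →ₗ[ℂ] D
  /-- The weighted matrix units. -/
  Y : Succ n → D
  star_ξ : ∀ a, star (ξ a) = ξ (star a)
  ξ_mul_ξ : ∀ a b, ξ a * ξ b = ξ 1 * ξ (a * b)
  star_Y_mul_Y : ∀ k l, star (Y k) * Y l = if k = l then 1 - ξ 1 else 0
  ξ_mul_Y : ∀ a i, ξ a * Y (Sum.inl i) = ∑ l, a l i • Y (Sum.inl l)
  ξ_mul_last : ∀ a, ξ a * Y (lastIdx n) = Y (lastIdx n) * ξ a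
  star_last : star (Y (lastIdx n)) = Y (lastIdx n)

/-- The parameters of the elements of the `*`-algebra generated by a system of weighted units. -/
abbrev Params (n : ℕ) : Type :=
  Mat (Fin n) × (Succ n → Succ n → ℂ) × (Succ n × Fin n → Succ n × Fin n → ℂ[X])

theorem Commute.aeval_right {D : Type*} [Ring D] [Algebra ℂ D] {x z : D} (h : Commute x z)
    (p : ℂ[X]) : Commute x (aeval z p) := by
  induction p using Polynomial.induction_on' with
  | add p q hp hq => rw [map_add]; exact hp.add_right hq
  | monomial m c =>
    rw [aeval_monomial]
    exact Commute.mul_right (Algebra.commutes c x).symm (h.pow_right m)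

theorem star_aeval {D : Type*} [Ring D] [StarRing D] [Algebra ℂ D] [StarModule ℂ D] {z : D}
    (h : star z = z) (p : ℂ[X]) : star (aeval z p) = aeval z (p.map (starRingEnd ℂ)) := by
  induction p using Polynomial.induction_on' with
  | add p q hp hq => rw [map_add, star_add, hp, hq, Polynomial.map_add, map_add]
  | monomial m c =>
    rw [aeval_monomial, Polynomial.map_monomial, aeval_monomial, ← Algebra.smul_def,
      ← Algebra.smul_def, star_smul, star_pow, h]
    rfl

namespace WeightedUnits

variable {n : ℕ} {D : Type*} [Ring D] [StarRing D] [Algebra ℂ D] [StarModule ℂ D]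

set_option linter.unusedSectionVars false

section Algebra

variable (S : WeightedUnits n D)

/-- The central element `∑ Y_k Y_k^*`. -/
def z : D := ∑ k, S.Y k * star (S.Y k)

/-- The element `Y_k ξ(a) Y_l^*`. -/
def W (k : Succ n) (a : Mat (Fin n)) (l : Succ n) : D := S.Y k * S.ξ a * star (S.Y l)

theorem W_sum {ι : Type*} (s : Finset ι) (k l : Succ n) (a : ι → Mat (Fin n)) :
    S.W k (∑ i ∈ s, a i) l = ∑ i ∈ s, S.W k (a i) l := by
  simp only [W, map_sum, Finset.mul_sum, Finset.sum_mul]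

theorem W_smul (c : ℂ) (k l : Succ n) (a : Mat (Fin n)) : S.W k (c • a) l = c • S.W k a l := by
  simp only [W, map_smul, mul_smul_comm, smul_mul_assoc]

theorem ξ_mul_one (a : Mat (Fin n)) : S.ξ a * S.ξ 1 = S.ξ 1 * S.ξ a := by
  rw [S.ξ_mul_ξ, mul_one]

theorem z_mul_Y (k : Succ n) : S.z * S.Y k = S.Y k * (1 - S.ξ 1) := by
  simp only [z, Finset.sum_mul, mul_assoc, star_Y_mul_Y, mul_ite, mul_zero]
  simp

theorem star_z : star S.z = S.z := by
  simp [z, star_sum]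

theorem star_Y_mul_z (k : Succ n) : star (S.Y k) * S.z = (1 - S.ξ 1) * star (S.Y k) := by
  have := congrArg star (S.z_mul_Y k)
  rwa [star_mul, star_mul, star_z, star_sub, star_one, star_ξ, star_one] at this

theorem z_mul_W (k l : Succ n) (a : Mat (Fin n)) :
    S.z * S.W k a l = S.Y k * ((1 - S.ξ 1) * S.ξ a) * star (S.Y l) := by
  rw [W, ← mul_assoc, ← mul_assoc, z_mul_Y, mul_assoc (S.Y k)]

theorem W_mul_z (k l : Succ n) (a : Mat (Fin n)) : S.W k a l * S.z = S.z * S.W k a l := by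
  rw [z_mul_W, W, mul_assoc, star_Y_mul_z, ← mul_assoc, mul_assoc (S.Y k), mul_sub, sub_mul,
    mul_one, one_mul, ξ_mul_one]

theorem one_sub_z_mul_W (k l : Succ n) (a : Mat (Fin n)) :
    (1 - S.z) * S.W k a l = S.Y k * (S.ξ 1 * S.ξ a) * star (S.Y l) := by
  rw [sub_mul, z_mul_W, one_mul, W]
  noncomm_ring

theorem last_mul_last : S.Y (lastIdx n) * S.Y (lastIdx n) = 1 - S.ξ 1 := by
  have := S.star_Y_mul_Y (lastIdx n) (lastIdx n)
  rwa [star_last, if_pos rfl] at this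

/-- Products of `ξ` with itself. -/
theorem ξ_mul_ξ_eq (a b : Mat (Fin n)) :
    S.ξ a * S.ξ b = S.ξ (a * b) - S.W (lastIdx n) (a * b) (lastIdx n) := by
  rw [W, ← ξ_mul_last, star_last, mul_assoc, last_mul_last, ξ_mul_ξ, mul_sub, ξ_mul_one]
  noncomm_ring

theorem star_Y_mul_ξ (a : Mat (Fin n)) (i : Fin n) :
    star (S.Y (Sum.inl i)) * S.ξ a = ∑ l, a i l • star (S.Y (Sum.inl l)) := by
  have := congrArg star (S.ξ_mul_Y (star a) i)
  simpa [star_sum, star_ξ, CStarMatrix.star_apply] using this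

theorem star_last_mul_ξ (a : Mat (Fin n)) :
    star (S.Y (lastIdx n)) * S.ξ a = S.ξ a * star (S.Y (lastIdx n)) := by
  rw [star_last, ξ_mul_last]

/-- The element `Y_k Y_l^*`. -/
def H (k l : Succ n) : D := S.Y k * star (S.Y l)

/-- Multiplying `H_{kl}` by `z` changes it only by an element of the third family, so `H_{kl}` needs
no polynomial coefficients in the spanning set. -/
theorem z_mul_H (k l : Succ n) : S.z * S.H k l = S.H k l - S.W k 1 l := by
  rw [H, ← mul_assoc, z_mul_Y, W]
  noncomm_ring

theorem H_mul_z (k l : Succ n) : S.H k l * S.z = S.z * S.H k l := by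
  rw [z_mul_H, H, W, mul_assoc, star_Y_mul_z]
  noncomm_ring

theorem ξ_mul_W_inl (a b : Mat (Fin n)) (i : Fin n) (l : Succ n) :
    S.ξ a * S.W (Sum.inl i) b l = ∑ m, a m i • S.W (Sum.inl m) b l := by
  simp only [W, ← mul_assoc, ξ_mul_Y, Finset.sum_mul, smul_mul_assoc]

theorem ξ_mul_W_last (a b : Mat (Fin n)) (l : Succ n) :
    S.ξ a * S.W (lastIdx n) b l = (1 - S.z) * S.W (lastIdx n) (a * b) l := by
  rw [one_sub_z_mul_W, ← ξ_mul_ξ, W]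
  simp only [← mul_assoc, ξ_mul_last]

theorem W_mul_ξ_inl (a b : Mat (Fin n)) (k : Succ n) (i : Fin n) :
    S.W k b (Sum.inl i) * S.ξ a = ∑ m, a i m • S.W k b (Sum.inl m) := by
  simp only [W, mul_assoc, star_Y_mul_ξ, Finset.mul_sum, mul_smul_comm]

theorem W_mul_ξ_last (a b : Mat (Fin n)) (k : Succ n) :
    S.W k b (lastIdx n) * S.ξ a = (1 - S.z) * S.W k (b * a) (lastIdx n) := by
  rw [one_sub_z_mul_W, ← ξ_mul_ξ, W]
  simp only [mul_assoc, star_last_mul_ξ]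

theorem ξ_mul_H_inl (a : Mat (Fin n)) (i : Fin n) (l : Succ n) :
    S.ξ a * S.H (Sum.inl i) l = ∑ m, a m i • S.H (Sum.inl m) l := by
  simp only [H, ← mul_assoc, ξ_mul_Y, Finset.sum_mul, smul_mul_assoc]

theorem ξ_mul_H_last (a : Mat (Fin n)) (l : Succ n) :
    S.ξ a * S.H (lastIdx n) l = S.W (lastIdx n) a l := by
  rw [H, W, ← mul_assoc, ξ_mul_last]

theorem H_mul_ξ_inl (a : Mat (Fin n)) (k : Succ n) (i : Fin n) :
    S.H k (Sum.inl i) * S.ξ a = ∑ m, a i m • S.H k (Sum.inl m) := by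
  simp only [H, mul_assoc, star_Y_mul_ξ, Finset.mul_sum, mul_smul_comm]

theorem H_mul_ξ_last (a : Mat (Fin n)) (k : Succ n) :
    S.H k (lastIdx n) * S.ξ a = S.W k a (lastIdx n) := by
  rw [H, W, mul_assoc, star_last_mul_ξ, mul_assoc]

theorem H_mul_H (k l k' l' : Succ n) :
    S.H k l * S.H k' l' = if l = k' then S.z * S.H k l' else 0 := by
  have : S.H k l * S.H k' l' = S.Y k * (star (S.Y l) * S.Y k') * star (S.Y l') := by
    simp only [H, mul_assoc]
  rw [this, star_Y_mul_Y, H, ← mul_assoc, z_mul_Y]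
  split_ifs <;> simp

theorem H_mul_W (k l k' l' : Succ n) (a : Mat (Fin n)) :
    S.H k l * S.W k' a l' = if l = k' then S.z * S.W k a l' else 0 := by
  have : S.H k l * S.W k' a l' = S.Y k * (star (S.Y l) * S.Y k') * S.ξ a * star (S.Y l') := by
    simp only [H, W, mul_assoc]
  rw [this, star_Y_mul_Y, z_mul_W]
  split_ifs <;> simp [mul_assoc]

theorem W_mul_H (k l k' l' : Succ n) (a : Mat (Fin n)) :
    S.W k a l * S.H k' l' = if l = k' then S.z * S.W k a l' else 0 := by
  have : S.W k a l * S.H k' l' = S.Y k * (S.ξ a * (star (S.Y l) * S.Y k')) * star (S.Y l') := by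
    simp only [H, W, mul_assoc]
  rw [this, star_Y_mul_Y, z_mul_W]
  split_ifs
  · rw [mul_sub, sub_mul, mul_one, one_mul, ξ_mul_one]
  · simp

/-- The factor `z - z²` reflects the model, where `Y_k ξ(e_{ij}) Y_l^*` is `t (1 - t)` times a
matrix unit. -/
theorem W_mul_W (k l k' l' : Succ n) (a b : Mat (Fin n)) :
    S.W k a l * S.W k' b l' = if l = k' then (S.z - S.z * S.z) * S.W k (a * b) l' else 0 := by
  have : S.W k a l * S.W k' b l' =
      S.Y k * (S.ξ a * (star (S.Y l) * S.Y k') * S.ξ b) * star (S.Y l') := by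
    simp only [W, mul_assoc]
  rw [this, star_Y_mul_Y]
  split_ifs
  · rw [show S.z - S.z * S.z = S.z * (1 - S.z) by noncomm_ring, mul_assoc S.z, one_sub_z_mul_W,
      ← ξ_mul_ξ, ← mul_assoc, ← mul_assoc S.z, ← mul_assoc S.z, z_mul_Y, mul_sub, mul_one,
      ξ_mul_one]
    noncomm_ring
  · simp

theorem star_W (k l : Succ n) (a : Mat (Fin n)) : star (S.W k a l) = S.W l (star a) k := by
  simp [W, star_ξ, mul_assoc]

theorem star_H (k l : Succ n) : star (S.H k l) = S.H l k := by
  simp [H]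

theorem z_eq_sum : S.z = ∑ k, S.H k k := rfl

/-- The first `n` summands of `z` form `∑ Y_i Y_i^*`, on which left and right multiplication by
`ξ(a)` both give `∑ a_{mi} Y_m Y_i^*`. The last summand commutes with `ξ(a)` because `Y_{n+1}` does.
-/
theorem ξ_mul_z (a : Mat (Fin n)) : S.ξ a * S.z = S.z * S.ξ a := by
  rw [z_eq_sum, Finset.mul_sum, Finset.sum_mul, Fintype.sum_sum_type, Fintype.sum_sum_type]
  simp only [ξ_mul_H_inl, H_mul_ξ_inl]
  rw [Finset.sum_comm]
  simp [ξ_mul_H_last, H_mul_ξ_last]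

/-- The spanning set of the `*`-algebra generated by a system of weighted units. -/
def gens : Set D :=
  {x | (∃ a, x = S.ξ a) ∨ (∃ k l, x = S.H k l) ∨
    ∃ (p : ℂ[X]) (k : Succ n) (a : Mat (Fin n)) (l : Succ n), x = aeval S.z p * S.W k a l}

/-- The linear span of the generators. -/
def range : Submodule ℂ D := Submodule.span ℂ S.gens

theorem ξ_mem_range (a : Mat (Fin n)) : S.ξ a ∈ S.range :=
  Submodule.subset_span (Or.inl ⟨a, rfl⟩)

theorem H_mem_range (k l : Succ n) : S.H k l ∈ S.range :=
  Submodule.subset_span (Or.inr (Or.inl ⟨k, l, rfl⟩))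

theorem aeval_mul_W_mem_range (p : ℂ[X]) (k l : Succ n) (a : Mat (Fin n)) :
    aeval S.z p * S.W k a l ∈ S.range :=
  Submodule.subset_span (Or.inr (Or.inr ⟨p, k, a, l, rfl⟩))

theorem W_mem_range (k l : Succ n) (a : Mat (Fin n)) : S.W k a l ∈ S.range := by
  simpa using S.aeval_mul_W_mem_range 1 k l a

theorem z_mul_H_mem_range (k l : Succ n) : S.z * S.H k l ∈ S.range := by
  rw [z_mul_H]
  exact sub_mem (S.H_mem_range k l) (S.W_mem_range k l 1)

theorem aeval_mul_mul_W_mem_range (p : ℂ[X]) {x : D} (q : ℂ[X]) (hx : x = aeval S.z q)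
    (k l : Succ n) (a : Mat (Fin n)) : aeval S.z p * (x * S.W k a l) ∈ S.range := by
  rw [hx, ← mul_assoc, ← map_mul]
  exact S.aeval_mul_W_mem_range _ k l a

theorem aeval_mul_smul_W_mem_range (p : ℂ[X]) {ι : Type*} (s : Finset ι) (c : ι → ℂ)
    (k l : ι → Succ n) (a : Mat (Fin n)) :
    aeval S.z p * (∑ i ∈ s, c i • S.W (k i) a (l i)) ∈ S.range := by
  rw [Finset.mul_sum]
  refine sum_mem fun i _ => ?_
  rw [mul_smul_comm]
  exact Submodule.smul_mem _ _ (S.aeval_mul_W_mem_range p _ _ a)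

theorem one_mem_range : (1 : D) ∈ S.range := by
  have : (1 : D) = S.ξ 1 + S.H (lastIdx n) (lastIdx n) := by
    rw [H, star_last, last_mul_last]
    noncomm_ring
  rw [this]
  exact add_mem (S.ξ_mem_range 1) (S.H_mem_range _ _)

theorem eq_inl_or_eq_last (k : Succ n) : (∃ i, k = Sum.inl i) ∨ k = lastIdx n := by
  rcases k with i | i
  · exact Or.inl ⟨i, rfl⟩
  · exact Or.inr (by rw [Subsingleton.elim i 0])

/-- There are nine cases, one for each pair of families. Since `z` commutes with all generators,
polynomials in `z` can be collected on the left, and the product rules above then finish each case.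
-/
theorem gens_mul_gens {x y : D} (hx : x ∈ S.gens) (hy : y ∈ S.gens) : x * y ∈ S.range := by
  have hX : S.z = aeval S.z (X : ℂ[X]) := (aeval_X _).symm
  have h1X : 1 - S.z = aeval S.z (1 - X : ℂ[X]) := by simp
  have hXX : S.z - S.z * S.z = aeval S.z (X - X * X : ℂ[X]) := by simp
  have hcomm : ∀ {x : D} (p : ℂ[X]) (y : D), x * S.z = S.z * x →
      x * (aeval S.z p * y) = aeval S.z p * (x * y) := by
    intro x p y h
    rw [← mul_assoc, (Commute.aeval_right h p).eq, mul_assoc]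
  rcases hx with ⟨a, rfl⟩ | ⟨k, l, rfl⟩ | ⟨p, k, a, l, rfl⟩ <;>
    rcases hy with ⟨b, rfl⟩ | ⟨k', l', rfl⟩ | ⟨q, k', b, l', rfl⟩
  · rw [ξ_mul_ξ_eq]
    exact sub_mem (S.ξ_mem_range _) (S.W_mem_range _ _ _)
  · rcases eq_inl_or_eq_last k' with ⟨i, rfl⟩ | rfl
    · rw [ξ_mul_H_inl]
      exact sum_mem fun m _ => Submodule.smul_mem _ _ (S.H_mem_range _ _)
    · rw [ξ_mul_H_last]
      exact S.W_mem_range _ _ _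
  · rw [hcomm q _ (S.ξ_mul_z a)]
    rcases eq_inl_or_eq_last k' with ⟨i, rfl⟩ | rfl
    · rw [ξ_mul_W_inl]
      exact S.aeval_mul_smul_W_mem_range _ _ _ _ _ _
    · rw [ξ_mul_W_last]
      exact S.aeval_mul_mul_W_mem_range _ _ h1X _ _ _
  · rcases eq_inl_or_eq_last l with ⟨i, rfl⟩ | rfl
    · rw [H_mul_ξ_inl]
      exact sum_mem fun m _ => Submodule.smul_mem _ _ (S.H_mem_range _ _)
    · rw [H_mul_ξ_last]
      exact S.W_mem_range _ _ _
  · rw [H_mul_H]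
    split_ifs
    · exact S.z_mul_H_mem_range _ _
    · exact zero_mem _
  · rw [hcomm q _ (S.H_mul_z k l), H_mul_W]
    split_ifs
    · exact S.aeval_mul_mul_W_mem_range _ _ hX _ _ _
    · rw [mul_zero]; exact zero_mem _
  · rw [mul_assoc]
    rcases eq_inl_or_eq_last l with ⟨i, rfl⟩ | rfl
    · rw [W_mul_ξ_inl]
      exact S.aeval_mul_smul_W_mem_range _ _ _ _ _ _
    · rw [W_mul_ξ_last]
      exact S.aeval_mul_mul_W_mem_range _ _ h1X _ _ _
  · rw [mul_assoc, W_mul_H]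
    split_ifs
    · exact S.aeval_mul_mul_W_mem_range _ _ hX _ _ _
    · rw [mul_zero]; exact zero_mem _
  · rw [mul_assoc, hcomm q _ (S.W_mul_z k l a), ← mul_assoc, ← map_mul, W_mul_W]
    split_ifs
    · exact S.aeval_mul_mul_W_mem_range _ _ hXX _ _ _
    · rw [mul_zero]; exact zero_mem _

theorem mul_mem_range {x y : D} (hx : x ∈ S.range) (hy : y ∈ S.range) : x * y ∈ S.range := by
  have : S.range * S.range ≤ S.range := by
    conv_lhs => rw [range, Submodule.span_mul_span]
    refine Submodule.span_le.mpr ?_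
    rintro _ ⟨x, hx, y, hy, rfl⟩
    exact S.gens_mul_gens hx hy
  exact this (Submodule.mul_mem_mul hx hy)

theorem star_mem_range {x : D} (hx : x ∈ S.range) : star x ∈ S.range := by
  induction hx using Submodule.span_induction with
  | mem x hx =>
    rcases hx with ⟨a, rfl⟩ | ⟨k, l, rfl⟩ | ⟨p, k, a, l, rfl⟩
    · rw [star_ξ]; exact S.ξ_mem_range _
    · rw [star_H]; exact S.H_mem_range _ _
    · rw [star_mul, star_W, star_aeval S.star_z,
        (Commute.aeval_right (S.W_mul_z _ _ _) _).eq]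
      exact S.aeval_mul_W_mem_range _ _ _ _
  | zero => rw [star_zero]; exact zero_mem _
  | add x y _ _ hx hy => rw [star_add]; exact add_mem hx hy
  | smul c x _ hx => rw [star_smul]; exact Submodule.smul_mem _ _ hx

/-- The parametrization of the `*`-algebra generated by a system of weighted units. -/
noncomputable def param : Params n →ₗ[ℂ] D where
  toFun p := S.ξ p.1 + ∑ k, ∑ l, p.2.1 k l • S.H k l +
    ∑ α, ∑ β, aeval S.z (p.2.2 α β) * S.W α.1 (unit α.2 β.2) β.1
  map_add' p q := by
    simp only [Prod.fst_add, Prod.snd_add, Pi.add_apply, map_add, add_smul, add_mul,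
      Finset.sum_add_distrib]
    abel
  map_smul' c p := by
    simp only [Prod.smul_fst, Prod.smul_snd, Pi.smul_apply, map_smul, smul_mul_assoc, smul_eq_mul,
      mul_smul, ← Finset.smul_sum, smul_add, RingHom.id_apply]

theorem param_apply (p : Params n) : S.param p = S.ξ p.1 + ∑ k, ∑ l, p.2.1 k l • S.H k l +
    ∑ α, ∑ β, aeval S.z (p.2.2 α β) * S.W α.1 (unit α.2 β.2) β.1 := rfl

theorem param_mem_range (p : Params n) : S.param p ∈ S.range :=
  add_mem (add_mem (S.ξ_mem_range _) (sum_mem fun k _ => sum_mem fun l _ =>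
    Submodule.smul_mem _ _ (S.H_mem_range k l))) (sum_mem fun _ _ => sum_mem fun _ _ =>
    S.aeval_mul_W_mem_range _ _ _ _)

theorem W_eq_sum (k l : Succ n) (a : Mat (Fin n)) :
    S.W k a l = ∑ i, ∑ j, a i j • S.W k (unit i j) l := by
  conv_lhs => rw [eq_sum_unit a]
  simp only [W_sum, W_smul]

theorem param_mat (a : Mat (Fin n)) : S.param (a, 0, 0) = S.ξ a := by
  simp [param_apply]

theorem param_matrixUnit (k l : Succ n) :
    S.param (0, fun k' l' => if k' = k ∧ l' = l then 1 else 0, 0) = S.H k l := by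
  simp [param_apply, ite_and]

theorem exists_param_eq {x : D} (hx : x ∈ S.range) : ∃ p, S.param p = x := by
  have : S.range ≤ LinearMap.range S.param := by
    refine Submodule.span_le.mpr ?_
    rintro x (⟨a, rfl⟩ | ⟨k, l, rfl⟩ | ⟨p, k, a, l, rfl⟩)
    · exact ⟨_, S.param_mat a⟩
    · exact ⟨_, S.param_matrixUnit k l⟩
    -- The matrix entries of `a` are absorbed into the polynomials, as parameters only use matrix
    -- units.
    · refine ⟨(0, 0, fun α β => if α.1 = k ∧ β.1 = l then a α.2 β.2 • p else 0), ?_⟩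
      rw [W_eq_sum]
      simp [param_apply, ite_and, Fintype.sum_prod_type, Finset.mul_sum, apply_ite (aeval S.z)]
  exact this hx

end Algebra

/-! ### Comparing two systems of weighted units -/

section Functoriality

variable {D' : Type*} [Ring D'] [StarRing D'] [Algebra ℂ D'] [StarModule ℂ D']
variable (S : WeightedUnits n D) (S' : WeightedUnits n D')

theorem map_param (ψ : D →⋆ₐ[ℂ] D') (hξ : ∀ a, ψ (S.ξ a) = S'.ξ a) (hY : ∀ k, ψ (S.Y k) = S'.Y k)
    (p : Params n) : ψ (S.param p) = S'.param p := by
  have hz : ψ S.z = S'.z := by simp [z, hY, map_star]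
  have ha : ∀ q : ℂ[X], ψ (aeval S.z q) = aeval S'.z q := by
    intro q
    rw [← hz]
    exact (Polynomial.aeval_algHom_apply ψ.toAlgHom S.z q).symm
  simp [param_apply, H, W, hξ, hY, map_star, ha]

/-- The product of two systems of weighted units. -/
def prod : WeightedUnits n (D × D') where
  ξ := S.ξ.prod S'.ξ
  Y k := (S.Y k, S'.Y k)
  star_ξ a := Prod.ext (S.star_ξ a) (S'.star_ξ a)
  ξ_mul_ξ a b := Prod.ext (S.ξ_mul_ξ a b) (S'.ξ_mul_ξ a b)
  star_Y_mul_Y k l := by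
    refine Prod.ext ((S.star_Y_mul_Y k l).trans ?_) ((S'.star_Y_mul_Y k l).trans ?_) <;>
      split_ifs <;> rfl
  ξ_mul_Y a i := by
    refine Prod.ext ((S.ξ_mul_Y a i).trans ?_) ((S'.ξ_mul_Y a i).trans ?_) <;>
      simp [Prod.fst_sum, Prod.snd_sum]
  ξ_mul_last a := Prod.ext (S.ξ_mul_last a) (S'.ξ_mul_last a)
  star_last := Prod.ext S.star_last S'.star_last

theorem prod_param (p : Params n) : (S.prod S').param p = (S.param p, S'.param p) :=
  Prod.ext (map_param (S.prod S') S (StarAlgHom.fst ℂ D D') (fun _ => rfl) (fun _ => rfl) p)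
    (map_param (S.prod S') S' (StarAlgHom.snd ℂ D D') (fun _ => rfl) (fun _ => rfl) p)

/-- Parameters are not assumed to be determined by the elements they represent, so no product on
parameters is chosen. Instead closure under products is applied to the product system in `D × D'`,
which yields one parameter valid in both algebras at once. -/
theorem exists_param_mul (p q : Params n) : ∃ r, S.param r = S.param p * S.param q ∧
    S'.param r = S'.param p * S'.param q := by
  obtain ⟨r, hr⟩ := (S.prod S').exists_param_eq
    ((S.prod S').mul_mem_range (param_mem_range _ p) (param_mem_range _ q))
  simp only [prod_param] at hr
  exact ⟨r, congrArg Prod.fst hr, congrArg Prod.snd hr⟩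

theorem exists_param_star (p : Params n) : ∃ r, S.param r = star (S.param p) ∧
    S'.param r = star (S'.param p) := by
  obtain ⟨r, hr⟩ := (S.prod S').exists_param_eq
    ((S.prod S').star_mem_range (param_mem_range _ p))
  simp only [prod_param] at hr
  exact ⟨r, congrArg Prod.fst hr, congrArg Prod.snd hr⟩

theorem exists_param_one : ∃ r, S.param r = 1 ∧ S'.param r = 1 := by
  obtain ⟨r, hr⟩ := (S.prod S').exists_param_eq (S.prod S').one_mem_range
  simp only [prod_param] at hr
  exact ⟨r, congrArg Prod.fst hr, congrArg Prod.snd hr⟩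

end Functoriality
end WeightedUnits

theorem mat_sum_apply {ι κ : Type*} (s : Finset κ) (f : κ → Mat ι) (i j : ι) :
    (∑ k ∈ s, f k) i j = ∑ k ∈ s, f k i j := by
  classical
  induction s using Finset.induction_on with
  | empty => simp
  | insert a s ha ih => rw [Finset.sum_insert ha, Finset.sum_insert ha, CStarMatrix.add_apply, ih]

/-! ### The matrices `e_i h^*` and the weighted units of a corner element -/

section Columns

variable {n : ℕ}

/-- The matrix `e_i h^*`. -/
def colMat (h : Fin n → ℂ) (i : Fin n) : Mat (Fin n) := fun k l => if k = i then star (h l) else 0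

theorem colMat_apply (h : Fin n → ℂ) (i k l : Fin n) :
    colMat h i k l = if k = i then star (h l) else 0 := rfl

theorem star_colMat_mul_colMat {e : Mat (Fin n)} {h : Fin n → ℂ}
    (he : ∀ i j, e i j = h i * star (h j)) (i j : Fin n) :
    star (colMat h i) * colMat h j = if i = j then e else 0 := by
  ext k l
  rw [CStarMatrix.mul_apply]
  simp only [CStarMatrix.star_apply, colMat_apply]
  rcases eq_or_ne i j with rfl | hij
  · simp [he]
  · simp [hij, hij.symm, apply_ite]

theorem mul_colMat (h : Fin n → ℂ) (a : Mat (Fin n)) (i : Fin n) :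
    a * colMat h i = ∑ l, a l i • colMat h l := by
  ext k l
  rw [CStarMatrix.mul_apply, mat_sum_apply]
  simp [colMat_apply]

theorem sum_smul_colMat {e : Mat (Fin n)} {h : Fin n → ℂ}
    (he : ∀ i j, e i j = h i * star (h j)) : ∑ i, h i • colMat h i = e := by
  ext k l
  rw [mat_sum_apply]
  simp [colMat_apply, he]

end Columns

namespace WeightedUnits

variable {n : ℕ}

section Construction

variable {D : Type*} [Ring D] [StarRing D] [Algebra ℂ D] [StarModule ℂ D]

/-- The weighted units `Y_i = ξ(e_i h^*) s` and `Y_{n+1} = d = |s|` obtained from an order zero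
map `ξ` and an element `s` with `ξ(h h^*) s = s` and `ξ(1) + s^* s = 1`. -/
def ofCorner (ξ : Mat (Fin n) →ₗ[ℂ] D) (hstar : ∀ a, star (ξ a) = ξ (star a))
    (hmul : ∀ a b, ξ a * ξ b = ξ 1 * ξ (a * b)) {e : Mat (Fin n)} (hee : e * e = e)
    {h : Fin n → ℂ} (he : ∀ i j, e i j = h i * star (h j)) {s d : D} (hs : ξ e * s = s)
    (hsum : ξ 1 + star s * s = 1) (hd : star d = d) (hdd : d * d = star s * s)
    (hcomm : ∀ a, ξ a * d = d * ξ a) (hds : d * s = 0) : WeightedUnits n D where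
  ξ := ξ
  Y := Sum.elim (fun i => ξ (colMat h i) * s) fun _ => d
  star_ξ := hstar
  ξ_mul_ξ := hmul
  star_Y_mul_Y k l := by
    -- `s = ξ(e)² s = ξ(1) ξ(e) s = ξ(1) s`, by the product formula and `e² = e`.
    have hcs : ξ 1 * s = s := by
      conv_lhs => rw [← hs, ← mul_assoc]
      rw [← hee, ← hmul, mul_assoc, hs, hs]
    have hsd : star s * d = 0 := by
      rw [← hd, ← star_mul, hds, star_zero]
    have h1 : 1 - ξ 1 = star s * s := by rw [← hsum]; abel
    rw [h1]
    rcases k with i | i <;> rcases l with j | j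
    · simp only [Sum.elim_inl, Sum.inl.injEq]
      rw [star_mul, hstar, mul_assoc, ← mul_assoc (ξ _), hmul, star_colMat_mul_colMat he]
      split_ifs
      · rw [mul_assoc, hs, hcs]
      · simp
    · simp only [Sum.elim_inl, Sum.elim_inr, reduceCtorEq, if_false]
      rw [star_mul, mul_assoc, hstar, hcomm, ← mul_assoc, hsd, zero_mul]
    · simp only [Sum.elim_inl, Sum.elim_inr, reduceCtorEq, if_false]
      rw [hd, ← mul_assoc, ← hcomm, mul_assoc, hds, mul_zero]
    · rw [Subsingleton.elim i j, if_pos rfl]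
      simp only [Sum.elim_inr]
      rw [hd, hdd]
  ξ_mul_Y a i := by
    have hcs : ξ 1 * s = s := by
      conv_lhs => rw [← hs, ← mul_assoc]
      rw [← hee, ← hmul, mul_assoc, hs, hs]
    have hc : ξ 1 * ξ (a * colMat h i) = ξ (a * colMat h i) * ξ 1 := by
      rw [hmul _ 1, mul_one]
    simp only [Sum.elim_inl]
    rw [← mul_assoc, hmul, hc, mul_assoc, hcs, mul_colMat, map_sum, Finset.sum_mul]
    simp only [map_smul, smul_mul_assoc]
  ξ_mul_last := hcomm
  star_last := hd

end Construction

/-! ### Norm estimates for weighted units in a C*-algebra -/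

section Bounds

variable {B : Type*} [CStarAlgebra B] [PartialOrder B] [StarOrderedRing B]
variable (S : WeightedUnits n B)

theorem z_nonneg : 0 ≤ S.z := Finset.sum_nonneg fun k _ => mul_star_self_nonneg (S.Y k)

/-- The difference `z - z²` is `∑ Y_k ξ(1) Y_k^*`, a sum of conjugates of a positive element. -/
theorem z_mul_z_le (hc : 0 ≤ S.ξ 1) : S.z * S.z ≤ S.z := by
  rw [← sub_nonneg]
  have : S.z - S.z * S.z = ∑ k, S.Y k * S.ξ 1 * star (S.Y k) := by
    conv_lhs => rw [z_eq_sum, Finset.mul_sum, ← Finset.sum_sub_distrib]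
    refine Finset.sum_congr rfl fun k _ => ?_
    rw [← z_eq_sum, z_mul_H, sub_sub_cancel, W]
  rw [this]
  exact Finset.sum_nonneg fun k _ => star_right_conjugate_nonneg hc (S.Y k)

theorem norm_z_le_one (hc : 0 ≤ S.ξ 1) : ‖S.z‖ ≤ 1 := by
  have h1 : ‖S.z * S.z‖ ≤ ‖S.z‖ := by
    refine CStarAlgebra.norm_le_norm_of_nonneg_of_le ?_ (S.z_mul_z_le hc)
    simpa [S.star_z] using star_mul_self_nonneg S.z
  have h2 : ‖S.z * S.z‖ = ‖S.z‖ * ‖S.z‖ := by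
    simpa [S.star_z] using CStarRing.norm_star_mul_self (x := S.z)
  rw [h2] at h1
  by_contra! h
  nlinarith

/-- The spectrum of `z` lies in `[0, 1]`, so this is the norm bound of the functional calculus. -/
theorem norm_aeval_z_le (hc : 0 ≤ S.ξ 1) {p : ℂ[X]} {C : ℝ}
    (hp : ∀ t : unitInterval, ‖p.eval ((t : ℝ) : ℂ)‖ ≤ C) : ‖aeval S.z p‖ ≤ C := by
  have hsa : IsSelfAdjoint S.z := S.star_z
  rw [← cfc_polynomial p S.z hsa.isStarNormal]
  refine norm_cfc_le ((norm_nonneg _).trans (hp 0)) fun x hx => ?_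
  rw [hsa.spectrumRestricts.algebraMap_image.symm] at hx
  obtain ⟨r, hr, rfl⟩ := hx
  have h0 : 0 ≤ r := spectrum_nonneg_of_nonneg S.z_nonneg hr
  have h1 : r ≤ 1 := by
    rcases subsingleton_or_nontrivial B with _ | _
    · simp [spectrum.of_subsingleton] at hr
    exact (le_abs_self r).trans ((spectrum.norm_le_norm_of_mem hr).trans (S.norm_z_le_one hc))
  exact hp ⟨r, h0, h1⟩

/-- A direct estimate would lose the factor `t (1 - t)`. The C*-identity keeps it, since multiplying
the element by its adjoint produces `z - z²`. -/
theorem norm_aeval_mul_W_le (hc : 0 ≤ S.ξ 1) {p : ℂ[X]} {C : ℝ}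
    (hp : ∀ t : unitInterval, ‖((X - X * X) * p).eval ((t : ℝ) : ℂ)‖ ≤ C) (k l : Succ n)
    (i j : Fin n) : ‖aeval S.z p * S.W k (unit i j) l‖ ≤ C := by
  have hC : 0 ≤ C := (norm_nonneg _).trans (hp 0)
  -- For `l = k` and `j = i` this reads `x² ≤ C x`, so `x ≤ C`; inserting that bound settles the
  -- general case.
  have key : ∀ (l : Succ n) (j : Fin n), ‖aeval S.z p * S.W k (unit i j) l‖ ^ 2 ≤
      C * ‖aeval S.z p * S.W k (unit i i) k‖ := by
    intro l j
    have e : aeval S.z p * S.W k (unit i j) l * star (aeval S.z p * S.W k (unit i j) l) =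
        aeval S.z ((X - X * X) * p) * star (aeval S.z p * S.W k (unit i i) k) := by
      rw [star_mul, star_mul, star_W, star_W, unit_star, unit_star, mul_assoc,
        ← mul_assoc (S.W _ _ _), W_mul_W, if_pos rfl, unit_mul_unit, if_pos rfl, map_mul]
      have hq : S.z - S.z * S.z = aeval S.z (X - X * X : ℂ[X]) := by simp
      rw [hq, mul_assoc, ← mul_assoc, ← map_mul, ← map_mul, mul_comm p]
    rw [sq, ← CStarRing.norm_self_mul_star, e]
    refine (norm_mul_le _ _).trans ?_
    rw [norm_star]
    exact mul_le_mul_of_nonneg_right (S.norm_aeval_z_le hc hp) (norm_nonneg _)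
  have h1 : ‖aeval S.z p * S.W k (unit i i) k‖ ≤ C := by
    have := key k i
    by_contra! h
    nlinarith
  have h2 := (key l j).trans (mul_le_mul_of_nonneg_left h1 hC)
  exact (sq_le_sq₀ (norm_nonneg _) hC).mp (by rwa [sq C])

theorem norm_param_le (hc : 0 ≤ S.ξ 1) : ∃ C : ℝ, ∀ (p : Params n) (M : ℝ),
    (∀ i j, ‖p.1 i j‖ ≤ M) → (∀ k l, ‖p.2.1 k l‖ ≤ M) →
    (∀ α β, ∀ t : unitInterval, ‖((X - X * X) * p.2.2 α β).eval ((t : ℝ) : ℂ)‖ ≤ M) →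
    ‖S.param p‖ ≤ C * M := by
  refine ⟨(∑ i, ∑ j, ‖S.ξ (unit i j)‖) + (∑ k, ∑ l, ‖S.H k l‖) +
    ∑ _α : Succ n × Fin n, ∑ _β : Succ n × Fin n, 1, fun p M h1 h2 h3 => ?_⟩
  rw [param_apply, add_mul, add_mul]
  refine (norm_add₃_le).trans (add_le_add (add_le_add ?_ ?_) ?_)
  · conv_lhs => rw [eq_sum_unit p.1]
    simp only [map_sum, map_smul, Finset.sum_mul]
    refine norm_sum_le_of_le _ fun i _ => norm_sum_le_of_le _ fun j _ => ?_
    rw [norm_smul, mul_comm]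
    exact mul_le_mul_of_nonneg_left (h1 i j) (norm_nonneg _)
  · simp only [Finset.sum_mul]
    refine norm_sum_le_of_le _ fun i _ => norm_sum_le_of_le _ fun j _ => ?_
    rw [norm_smul, mul_comm]
    exact mul_le_mul_of_nonneg_left (h2 i j) (norm_nonneg _)
  · simp only [Finset.sum_mul, one_mul]
    exact norm_sum_le_of_le _ fun α _ => norm_sum_le_of_le _ fun β _ =>
      S.norm_aeval_mul_W_le hc (h3 α β) _ _ _ _

end Bounds
end WeightedUnits

/-! ### The supremum norm on the dimension drop algebra -/

section DimDropNorm

variable {ι κ : Type*} [Fintype ι] [DecidableEq ι] [Fintype κ] [DecidableEq κ]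

noncomputable abbrev ringDimDrop : Ring (dimDrop ι κ) where
  __ := (inferInstance : Semiring (dimDrop ι κ))
  neg f := ⟨-f, by
    simpa using (dimDrop ι κ).smul_mem f.2 (-1 : ℂ)⟩
  neg_add_cancel f := Subtype.ext (neg_add_cancel (f : C(unitInterval, Mat (ι × κ))))
  zsmul := @zsmulRec _ ⟨0⟩ ⟨(· + ·)⟩ ⟨fun f => ⟨-f, by
    simpa using (dimDrop ι κ).smul_mem f.2 (-1 : ℂ)⟩⟩ nsmulRec
  zsmul_zero' _ := rfl
  zsmul_succ' _ _ := rfl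
  zsmul_neg' _ _ := rfl

/-- Completeness of the dimension drop algebra is never needed: it is only the source of the
extension by continuity, and `B` is the complete target. -/
noncomputable abbrev normedRingDimDrop : NormedRing (dimDrop ι κ) where
  __ := ringDimDrop
  __ := (inferInstance : MetricSpace (dimDrop ι κ))
  norm f := ‖(f : C(unitInterval, Mat (ι × κ)))‖
  dist_eq f g := dist_eq_norm_neg_add (f : C(unitInterval, Mat (ι × κ))) g
  norm_mul_le f g := norm_mul_le (f : C(unitInterval, Mat (ι × κ))) g

attribute [local instance] ringDimDrop normedRingDimDrop

theorem norm_coe_dimDrop (f : dimDrop ι κ) : ‖f‖ = ‖(f : C(unitInterval, Mat (ι × κ)))‖ := rfl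

noncomputable abbrev normedSpaceDimDrop : NormedSpace ℂ (dimDrop ι κ) where
  __ := (inferInstance : Module ℂ (dimDrop ι κ))
  norm_smul_le c f := norm_smul_le c (f : C(unitInterval, Mat (ι × κ)))

end DimDropNorm

attribute [local instance] ringDimDrop normedRingDimDrop normedSpaceDimDrop

/-! ### Evaluation with the flip path removed -/

section Fiber

variable {n : ℕ}

theorem flip_mul_flip : flip n * flip n = 1 := by
  ext ⟨i, j⟩ q
  rw [flip_mul]
  rcases j with j | j <;> rcases q with ⟨k, l | l⟩ <;>
    simp [flip, CStarMatrix.one_apply, and_comm, Fin.fin_one_eq_zero]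

theorem star_flipPath_mul (t : unitInterval) : star (flipPath n t) * flipPath n t = 1 := by
  set E := Complex.exp (Real.pi * (t : ℝ) * Complex.I) with hE
  have hEE : star E * E = 1 := by
    have : ‖E‖ = 1 := by
      rw [hE, ← Complex.ofReal_mul]; exact Complex.norm_exp_ofReal_mul_I _
    have h2 := Complex.conj_mul' E
    rw [this] at h2
    simpa using h2
  have h2 : star (2 : ℂ) = 2 := by simp
  simp only [flipPath, ← hE, star_add, star_smul, flip_star, star_one, star_div₀, star_sub, h2,
    mul_add, add_mul, smul_mul_smul_comm, mul_one, one_mul, flip_mul_flip]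
  have : ∀ a b c d : ℂ, a + d = 1 → b + c = 0 →
      a • (1 : Mat (Fin n × Succ n)) + b • flip n + (c • flip n + d • 1) = 1 := by
    intro a b c d h1 h2
    rw [show a • (1 : Mat (Fin n × Succ n)) + b • flip n + (c • flip n + d • 1) =
      (a + d) • 1 + (b + c) • flip n by module, h1, h2, one_smul, zero_smul, add_zero]
  apply this
  · linear_combination (1 / 2) * hEE
  · linear_combination (-1 / 2) * hEE

theorem flipPath_mul_star (t : unitInterval) : flipPath n t * star (flipPath n t) = 1 :=
  (mul_eq_one_comm (M := Matrix (Fin n × Succ n) (Fin n × Succ n) ℂ)).mp (star_flipPath_mul t)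

/-- The flip path as a path of unitaries. -/
noncomputable def flipUnitary (n : ℕ) (t : unitInterval) : unitary (Mat (Fin n × Succ n)) :=
  ⟨flipPath n t, Unitary.mem_iff.mpr ⟨star_flipPath_mul t, flipPath_mul_star t⟩⟩

/-- The evaluation `f ↦ u_t f(t) u_t^*`. -/
noncomputable def fiber (t : unitInterval) :
    dimDrop (Fin n) (Succ n) →⋆ₐ[ℂ] Mat (Fin n × Succ n) :=
  let φ := Unitary.conjStarAlgAut ℂ (Mat (Fin n × Succ n)) (flipUnitary n t)
  { toFun := fun f => φ ((f : C(unitInterval, Mat (Fin n × Succ n))) t)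
    map_one' := map_one φ
    map_mul' := fun _ _ => map_mul φ _ _
    map_zero' := map_zero φ
    map_add' := fun _ _ => map_add φ _ _
    commutes' := fun c => (AlgHomClass.commutes φ c)
    map_star' := fun _ => map_star φ _ }

theorem fiber_apply (t : unitInterval) (f : dimDrop (Fin n) (Succ n)) :
    fiber t f = flipPath n t * (f : C(unitInterval, Mat (Fin n × Succ n))) t *
      star (flipPath n t) := rfl

theorem fiber_ext {f g : dimDrop (Fin n) (Succ n)} (h : ∀ t, fiber t f = fiber t g) : f = g := by
  refine Subtype.ext (ContinuousMap.ext fun t => ?_)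
  have := congrArg (fun x => star (flipPath n t) * x * flipPath n t) (h t)
  simpa [fiber_apply, mul_assoc, star_flipPath_mul, ← mul_assoc (star (flipPath n t)) (flipPath n t)]
    using this

theorem fiber_of_conj {t : unitInterval} {f : dimDrop (Fin n) (Succ n)} {m : Mat (Fin n × Succ n)}
    (h : (f : C(unitInterval, Mat (Fin n × Succ n))) t =
      star (flipPath n t) * m * flipPath n t) : fiber t f = m := by
  rw [fiber_apply, h]
  simp only [← mul_assoc, flipPath_mul_star, one_mul]
  rw [mul_assoc, flipPath_mul_star, mul_one]

/-- The diagonal matrix `diag(1, …, 1, 1 - t)`. -/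
noncomputable def weight (n : ℕ) (t : unitInterval) : Mat (Succ n) :=
  1 - ((t : ℝ) : ℂ) • lastProj n

theorem fiber_embed (t : unitInterval) (x : Mat (Fin n)) :
    fiber t (embed x) = kron x (weight n t) := fiber_of_conj rfl

theorem fiber_corner (t : unitInterval) (h : Fin n → ℂ) :
    fiber t (corner h) = ((Real.sqrt (t : ℝ) : ℝ) : ℂ) • cornerMat h :=
  fiber_of_conj (by simp only [mul_smul_comm, smul_mul_assoc]; rfl)

theorem lastProj_mul_lastProj : lastProj n * lastProj n = lastProj n := by
  rw [lastProj, directSum_mul, mul_zero, mul_one]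

theorem star_lastProj : star (lastProj n) = lastProj n := by
  rw [lastProj, directSum_star, star_zero, star_one]

/-- The function `t ↦ g(t) u_t^* (1 ⊗ e_{n+1,n+1}) u_t`, where `g` vanishes at `0`. -/
noncomputable def lastPath (n : ℕ) (g : C(unitInterval, ℂ)) (hg : g 0 = 0) :
    dimDrop (Fin n) (Succ n) :=
  ⟨⟨fun t => g t • (star (flipPath n t) * kron 1 (lastProj n) * flipPath n t), by
      have h := continuous_flipPath n
      fun_prop⟩, by
    refine ⟨⟨0, ?_⟩, g 1 • lastProj n, ?_⟩
    · rw [ContinuousMap.coe_mk, hg, zero_smul ℂ]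
      ext p q
      simp [kron_apply]
    · rw [ContinuousMap.coe_mk, flipPath_one, flip_star, kron_smul_right]
      congr 1
      ext ⟨i, j⟩ ⟨k, l⟩
      rw [mul_flip, flip_mul]
      rcases j with j | j <;> rcases l with l | l <;>
        simp [kron_apply, lastProj, directSum, CStarMatrix.one_apply]⟩

theorem fiber_lastPath (t : unitInterval) (g : C(unitInterval, ℂ)) (hg : g 0 = 0) :
    fiber t (lastPath n g hg) = g t • kron 1 (lastProj n) :=
  fiber_of_conj (by simp only [mul_smul_comm, smul_mul_assoc]; rfl)

end Fiber

/-! ### The weighted units of the dimension drop algebra -/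

section Model

variable {n : ℕ}

theorem cornerMat_apply (h : Fin n → ℂ) (p q : Fin n × Succ n) :
    cornerMat h p q = if q.2 = lastIdx n ∧ p.2 = Sum.inl q.1 then h p.1 else 0 := by
  obtain ⟨i, j | j⟩ := p <;> obtain ⟨k, l | l⟩ := q <;>
    simp [cornerMat, Fin.fin_one_eq_zero]

theorem lastProj_apply (p q : Succ n) :
    lastProj n p q = if p = lastIdx n ∧ q = lastIdx n then 1 else 0 := by
  obtain i | i := p <;> obtain j | j := q <;>
    simp [lastProj, directSum, Fin.fin_one_eq_zero]

theorem weight_apply (t : unitInterval) (p q : Succ n) :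
    weight n t p q = (if p = q then 1 else 0) -
      if p = lastIdx n ∧ q = lastIdx n then ((t : ℝ) : ℂ) else 0 := by
  rw [weight, CStarMatrix.sub_apply, CStarMatrix.smul_apply, lastProj_apply, CStarMatrix.one_apply]
  simp

theorem star_weight (t : unitInterval) : star (weight n t) = weight n t := by
  simp [weight, star_lastProj]

theorem weight_mul_lastProj (t : unitInterval) :
    weight n t * lastProj n = lastProj n * weight n t := by
  simp only [weight, sub_mul, mul_sub, one_mul, mul_one, smul_mul_assoc, mul_smul_comm]

theorem kron_mul_cornerMat (a : Mat (Fin n)) (t : unitInterval) (h : Fin n → ℂ) :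
    kron a (weight n t) * cornerMat h = cornerMat fun i => ∑ j, a i j * h j := by
  ext ⟨i, j⟩ ⟨k, l⟩
  rw [CStarMatrix.mul_apply, Fintype.sum_prod_type]
  simp only [cornerMat_apply, kron_apply, weight_apply]
  rcases j with j | j <;> simp [ite_and, Finset.sum_ite_irrel]

theorem star_cornerMat_mul_cornerMat {h : Fin n → ℂ} (hh : ∑ i, star (h i) * h i = 1) :
    star (cornerMat h) * cornerMat h = kron 1 (lastProj n) := by
  ext ⟨i, j⟩ ⟨k, l⟩
  rw [CStarMatrix.mul_apply, Fintype.sum_prod_type]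
  simp only [CStarMatrix.star_apply, cornerMat_apply, kron_apply, lastProj_apply,
    CStarMatrix.one_apply]
  have : ∑ i, (starRingEnd ℂ) (h i) * h i = 1 := hh
  rcases j with j | j <;> rcases l with l | l <;> 
    simp [Fin.fin_one_eq_zero]
  rcases eq_or_ne i k with rfl | hik
  · simp [this]
  · simp [hik, hik.symm]

theorem kron_lastProj_mul_cornerMat (h : Fin n → ℂ) :
    kron 1 (lastProj n) * cornerMat h = 0 := by
  ext ⟨i, j⟩ ⟨k, l⟩
  rw [CStarMatrix.mul_apply, Fintype.sum_prod_type]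
  simp only [cornerMat_apply, kron_apply, lastProj_apply]
  rcases j with j | j <;> simp [ite_and, Finset.sum_ite_irrel]

theorem weight_mul_lastProj_comm (a : Mat (Fin n)) (t : unitInterval) :
    kron a (weight n t) * kron 1 (lastProj n) = kron 1 (lastProj n) * kron a (weight n t) := by
  rw [kron_mul, kron_mul, one_mul, mul_one, weight_mul_lastProj]

/-- The canonical order zero embedding as a linear map. -/
noncomputable def embedₗ (n : ℕ) : Mat (Fin n) →ₗ[ℂ] dimDrop (Fin n) (Succ n) where
  toFun := embed
  map_add' x y := fiber_ext fun t => by simp only [map_add, fiber_embed, kron_add_left]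
  map_smul' c x := fiber_ext fun t => by
    simp only [map_smul, fiber_embed, kron_smul_left, RingHom.id_apply]

/-- The square root function on the unit interval. -/
noncomputable def sqrtFun : C(unitInterval, ℂ) :=
  ⟨fun t => ((Real.sqrt (t : ℝ) : ℝ) : ℂ), by fun_prop⟩

theorem sqrtFun_mul_self (t : unitInterval) :
    ((Real.sqrt (t : ℝ) : ℝ) : ℂ) * ((Real.sqrt (t : ℝ) : ℝ) : ℂ) = ((t : ℝ) : ℂ) := by
  rw [← Complex.ofReal_mul, Real.mul_self_sqrt t.2.1]

/-- The absolute value of the elements `corner h`. -/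
noncomputable def absCorner (n : ℕ) : dimDrop (Fin n) (Succ n) :=
  lastPath n sqrtFun (by simp [sqrtFun])

theorem fiber_absCorner (t : unitInterval) :
    fiber t (absCorner n) = ((Real.sqrt (t : ℝ) : ℝ) : ℂ) • kron 1 (lastProj n) :=
  fiber_lastPath t _ _

/-- The explicit root, with weight `t^{1/4}`, shows that every `*`-homomorphism maps `absCorner` to
a positive element, without an order or functional calculus on the source. -/
theorem exists_absCorner_eq (n : ℕ) : ∃ r, absCorner n = star r * r := by
  refine ⟨lastPath n ⟨fun t => ((Real.sqrt (Real.sqrt (t : ℝ)) : ℝ) : ℂ), by fun_prop⟩ (by simp),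
    fiber_ext fun t => ?_⟩
  rw [map_mul, map_star, fiber_absCorner, fiber_lastPath]
  simp only [star_smul, smul_mul_smul_comm, kron_star, kron_mul, star_lastProj,
    lastProj_mul_lastProj, star_one, mul_one]
  congr 1
  simp only [ContinuousMap.coe_mk, Complex.star_def, Complex.conj_ofReal]
  rw [← Complex.ofReal_mul, Real.mul_self_sqrt (Real.sqrt_nonneg _)]

theorem star_embed (x : Mat (Fin n)) : star (embed x) = embed (star x) :=
  fiber_ext fun t => by simp only [map_star, fiber_embed, kron_star, star_weight]

theorem embed_mul_embed (x y : Mat (Fin n)) : embed x * embed y = embed 1 * embed (x * y) :=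
  fiber_ext fun t => by simp only [map_mul, fiber_embed, kron_mul, one_mul]

variable {e : Mat (Fin n)} {h : Fin n → ℂ}

theorem embed_mul_corner (he : ∀ i j, e i j = h i * star (h j))
    (hh : ∑ i, star (h i) * h i = 1) : embed e * corner h = corner h :=
  fiber_ext fun t => by
    simp only [map_mul, fiber_embed, fiber_corner, mul_smul_comm, kron_mul_cornerMat]
    congr 2
    funext i
    simp only [he, mul_assoc, ← Finset.mul_sum, hh, mul_one]

theorem star_corner_mul_corner (hh : ∑ i, star (h i) * h i = 1) :
    star (corner h) * corner h = absCorner n * absCorner n :=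
  fiber_ext fun t => by
    simp only [map_mul, map_star, fiber_corner, fiber_absCorner, star_smul, smul_mul_smul_comm,
      star_cornerMat_mul_cornerMat hh, kron_mul, lastProj_mul_lastProj, mul_one, Complex.star_def,
      Complex.conj_ofReal]

theorem embed_one_add_star_corner_mul_corner (hh : ∑ i, star (h i) * h i = 1) :
    embed 1 + star (corner h) * corner h = 1 :=
  fiber_ext fun t => by
    rw [star_corner_mul_corner hh, map_add, map_mul, fiber_embed, fiber_absCorner,
      smul_mul_smul_comm, kron_mul, lastProj_mul_lastProj, mul_one, sqrtFun_mul_self, map_one,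
      ← kron_smul_right, ← kron_add_right, weight, sub_add_cancel, kron_one]

theorem star_absCorner : star (absCorner n) = absCorner n :=
  fiber_ext fun t => by
    simp only [map_star, fiber_absCorner, star_smul, kron_star, star_one, star_lastProj,
      Complex.star_def, Complex.conj_ofReal]

theorem embed_mul_absCorner (x : Mat (Fin n)) : embed x * absCorner n = absCorner n * embed x :=
  fiber_ext fun t => by
    simp only [map_mul, fiber_embed, fiber_absCorner, mul_smul_comm, smul_mul_assoc,
      weight_mul_lastProj_comm]

theorem absCorner_mul_corner (h : Fin n → ℂ) : absCorner n * corner h = 0 :=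
  fiber_ext fun t => by
    simp only [map_mul, fiber_corner, fiber_absCorner, smul_mul_smul_comm,
      kron_lastProj_mul_cornerMat, smul_zero, map_zero]

/-- The weighted units of the dimension drop algebra. -/
noncomputable def model (hee : e * e = e) (he : ∀ i j, e i j = h i * star (h j))
    (hh : ∑ i, star (h i) * h i = 1) : WeightedUnits n (dimDrop (Fin n) (Succ n)) :=
  WeightedUnits.ofCorner (embedₗ n) star_embed embed_mul_embed hee he (embed_mul_corner he hh)
    (embed_one_add_star_corner_mul_corner hh) star_absCorner (star_corner_mul_corner hh).symm
    embed_mul_absCorner (absCorner_mul_corner h)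

/-- The identification of `ℂ^{n+1} ⊗ ℂ^n = (ℂ^n ⊗ ℂ^n) ⊕ ℂ^n` with `ℂ^n ⊗ ℂ^{n+1}`. -/
def swapIdx (n : ℕ) : Succ n × Fin n ≃ Fin n × Succ n where
  toFun p := Sum.elim (fun i => (i, Sum.inl p.2)) (fun _ => (p.2, lastIdx n)) p.1
  invFun p := Sum.elim (fun j => (Sum.inl p.1, j)) (fun _ => (lastIdx n, p.1)) p.2
  left_inv := by rintro ⟨i | i, j⟩ <;> simp [Fin.fin_one_eq_zero]
  right_inv := by rintro ⟨i, j | j⟩ <;> simp [Fin.fin_one_eq_zero]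

/-- The matrix `∑_j |k, j⟩⟨n + 1, j|`. -/
def colUnit (k : Succ n) : Mat (Fin n × Succ n) := fun p q =>
  if q.2 = lastIdx n ∧ p = swapIdx n (k, q.1) then 1 else 0

theorem colUnit_apply (k : Succ n) (p q : Fin n × Succ n) :
    colUnit k p q = if q.2 = lastIdx n ∧ p = swapIdx n (k, q.1) then 1 else 0 := rfl

theorem cornerMat_single (i : Fin n) :
    cornerMat (fun k => if k = i then 1 else 0) = colUnit (Sum.inl i) := by
  ext p ⟨k, l⟩
  obtain ⟨i', j⟩ := p
  simp only [cornerMat_apply, colUnit_apply, swapIdx, Equiv.coe_fn_mk, Sum.elim_inl, Prod.mk.injEq]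
  split_ifs <;> tauto

theorem kron_one_lastProj : kron 1 (lastProj n) = colUnit (lastIdx n) := by
  ext ⟨i', j⟩ ⟨k, l⟩
  simp only [kron_apply, lastProj_apply, CStarMatrix.one_apply, colUnit_apply, swapIdx,
    Equiv.coe_fn_mk, Sum.elim_inr, Prod.mk.injEq]
  split_ifs <;> simp <;> tauto

theorem fiber_model_Y (hee : e * e = e) (he : ∀ i j, e i j = h i * star (h j))
    (hh : ∑ i, star (h i) * h i = 1) (t : unitInterval) (k : Succ n) :
    fiber t ((model hee he hh).Y k) = ((Real.sqrt (t : ℝ) : ℝ) : ℂ) • colUnit k := by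
  rcases k with i | i
  · change fiber t (embed (colMat h i) * corner h) = _
    rw [map_mul, fiber_embed, fiber_corner, mul_smul_comm, kron_mul_cornerMat, ← cornerMat_single]
    congr 2
    funext k
    simp only [colMat_apply, ite_mul, zero_mul, ← hh]
    split_ifs <;> simp
  · change fiber t (absCorner n) = _
    rw [fiber_absCorner, kron_one_lastProj, Subsingleton.elim i 0]

theorem colUnit_mul_star_colUnit (k l : Succ n) (a b : Succ n × Fin n) :
    (colUnit k * star (colUnit l)) (swapIdx n a) (swapIdx n b) =
      if a.1 = k ∧ b.1 = l ∧ a.2 = b.2 then 1 else 0 := by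
  rw [CStarMatrix.mul_apply, Fintype.sum_prod_type]
  obtain ⟨a1, a2⟩ := a
  obtain ⟨b1, b2⟩ := b
  simp only [CStarMatrix.star_apply, colUnit_apply, EmbeddingLike.apply_eq_iff_eq, Prod.mk.injEq]
  simp [ite_and]
  split_ifs <;> simp_all

theorem colUnit_mul_kron_mul_star_colUnit (k l : Succ n) (i j : Fin n) (t : unitInterval) :
    colUnit k * kron (unit i j) (weight n t) * star (colUnit l) =
      (1 - ((t : ℝ) : ℂ)) • unit (swapIdx n (k, i)) (swapIdx n (l, j)) := by
  ext p q
  obtain ⟨a, rfl⟩ := (swapIdx n).surjective p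
  obtain ⟨b, rfl⟩ := (swapIdx n).surjective q
  simp only [CStarMatrix.mul_apply, Fintype.sum_prod_type, CStarMatrix.star_apply, colUnit_apply,
    kron_apply, unit_apply, weight_apply, CStarMatrix.smul_apply, EmbeddingLike.apply_eq_iff_eq]
  obtain ⟨a1, a2⟩ := a
  obtain ⟨b1, b2⟩ := b
  simp [ite_and]
  split_ifs <;> simp_all

end Model

/-! ### Norms and continuity of fibers -/

section Norm

variable {n : ℕ}

theorem norm_fiber (t : unitInterval) (f : dimDrop (Fin n) (Succ n)) :
    ‖fiber t f‖ = ‖(f : C(unitInterval, Mat (Fin n × Succ n))) t‖ := by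
  have h1 := CStarRing.norm_coe_unitary_mul (flipUnitary n t)
    ((f : C(unitInterval, Mat (Fin n × Succ n))) t)
  have h2 := CStarRing.norm_mul_coe_unitary
    (flipPath n t * (f : C(unitInterval, Mat (Fin n × Succ n))) t) (star (flipUnitary n t))
  rw [fiber_apply]
  exact h2.trans h1

theorem norm_fiber_le (t : unitInterval) (f : dimDrop (Fin n) (Succ n)) : ‖fiber t f‖ ≤ ‖f‖ := by
  rw [norm_fiber, norm_coe_dimDrop]
  exact ContinuousMap.norm_coe_le_norm _ t

theorem norm_le_of_forall_fiber {f : dimDrop (Fin n) (Succ n)} {C : ℝ} (hC : 0 ≤ C)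
    (h : ∀ t, ‖fiber t f‖ ≤ C) : ‖f‖ ≤ C := by
  rw [norm_coe_dimDrop, ContinuousMap.norm_le _ hC]
  intro t
  rw [← norm_fiber]
  exact h t

theorem continuous_entry {ι : Type*} [Fintype ι] (i j : ι) : Continuous fun m : Mat ι => m i j :=
  continuous_apply_apply (ρ := fun _ _ => ℂ) i j

theorem continuous_fiber (f : dimDrop (Fin n) (Succ n)) : Continuous fun t => fiber t f := by
  simp only [fiber_apply]
  have := continuous_flipPath n
  fun_prop

end Norm

/-! ### Reading off the parameters from an element of the model -/

section Param

variable {n : ℕ} {e : Mat (Fin n)} {h : Fin n → ℂ} (hee : e * e = e)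
  (he : ∀ i j, e i j = h i * star (h j)) (hh : ∑ i, star (h i) * h i = 1)

theorem fiber_model_H (t : unitInterval) (k l : Succ n) :
    fiber t ((model hee he hh).H k l) = ((t : ℝ) : ℂ) • (colUnit k * star (colUnit l)) := by
  rw [WeightedUnits.H, map_mul, map_star, fiber_model_Y, fiber_model_Y, star_smul,
    smul_mul_smul_comm, Complex.star_def, Complex.conj_ofReal, sqrtFun_mul_self]

theorem sum_colUnit_mul_star_colUnit :
    ∑ k : Succ n, colUnit k * star (colUnit k) = (1 : Mat (Fin n × Succ n)) := by
  ext p q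
  obtain ⟨a, rfl⟩ := (swapIdx n).surjective p
  obtain ⟨b, rfl⟩ := (swapIdx n).surjective q
  rw [mat_sum_apply]
  simp only [colUnit_mul_star_colUnit, CStarMatrix.one_apply, EmbeddingLike.apply_eq_iff_eq,
    Prod.ext_iff, ite_and]
  simp [eq_comm]

theorem fiber_model_z (t : unitInterval) :
    fiber t (model hee he hh).z = algebraMap ℂ (Mat (Fin n × Succ n)) ((t : ℝ) : ℂ) := by
  rw [WeightedUnits.z_eq_sum, map_sum]
  simp only [fiber_model_H]
  rw [← Finset.smul_sum, sum_colUnit_mul_star_colUnit, Algebra.algebraMap_eq_smul_one]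

theorem fiber_model_aeval (t : unitInterval) (p : ℂ[X]) :
    fiber t (aeval (model hee he hh).z p) =
      algebraMap ℂ (Mat (Fin n × Succ n)) (p.eval ((t : ℝ) : ℂ)) := by
  have := Polynomial.aeval_algHom_apply (fiber (n := n) t).toAlgHom (model hee he hh).z p
  refine this.symm.trans ?_
  rw [show (fiber (n := n) t).toAlgHom (model hee he hh).z = _ from fiber_model_z hee he hh t,
    aeval_algebraMap_apply]
  simp

theorem fiber_model_W (t : unitInterval) (k l : Succ n) (i j : Fin n) :
    fiber t ((model hee he hh).W k (unit i j) l) =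
      (((t : ℝ) : ℂ) * (1 - ((t : ℝ) : ℂ))) • unit (swapIdx n (k, i)) (swapIdx n (l, j)) := by
  rw [WeightedUnits.W, map_mul, map_mul, map_star, fiber_model_Y, fiber_model_Y,
    show fiber t ((model hee he hh).ξ (unit i j)) = _ from fiber_embed t (unit i j), star_smul,
    smul_mul_assoc, smul_mul_smul_comm, Complex.star_def, Complex.conj_ofReal, sqrtFun_mul_self,
    colUnit_mul_kron_mul_star_colUnit, smul_smul]

theorem fiber_model_param (t : unitInterval) (p : Params n) :
    fiber t ((model hee he hh).param p) = kron p.1 (weight n t) +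
      (∑ k, ∑ l, (((t : ℝ) : ℂ) * p.2.1 k l) • (colUnit k * star (colUnit l))) +
      ∑ α, ∑ β, ((X - X * X) * p.2.2 α β).eval ((t : ℝ) : ℂ) •
        unit (swapIdx n α) (swapIdx n β) := by
  rw [WeightedUnits.param_apply, map_add, map_add,
    show fiber t ((model hee he hh).ξ p.1) = _ from fiber_embed t p.1]
  simp only [map_sum, map_smul, map_mul, fiber_model_H, fiber_model_aeval, fiber_model_W,
    smul_smul, Algebra.algebraMap_eq_smul_one, smul_mul_assoc, one_mul, eval_mul, eval_sub, eval_X]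
  refine congrArg₂ (· + ·) (congrArg₂ (· + ·) rfl ?_) ?_
  · refine Finset.sum_congr rfl fun k _ => Finset.sum_congr rfl fun l _ => ?_
    rw [mul_comm]
  · refine Finset.sum_congr rfl fun α _ => Finset.sum_congr rfl fun β _ => ?_
    congr 1
    ring

/-- At `t = 0` only `a ⊗ 1` survives. At `t = 1` only `a ⊕ 0` and the second parameter survive, and
the polynomial part vanishes at both ends. The coefficient bounds and the correction of boundary
values both rest on this formula. -/
theorem fiber_model_param_apply (t : unitInterval) (p : Params n) (α β : Succ n × Fin n) :
    fiber t ((model hee he hh).param p) (swapIdx n α) (swapIdx n β) =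
      kron p.1 (weight n t) (swapIdx n α) (swapIdx n β) +
      (if α.2 = β.2 then ((t : ℝ) : ℂ) * p.2.1 α.1 β.1 else 0) +
      ((X - X * X) * p.2.2 α β).eval ((t : ℝ) : ℂ) := by
  rw [fiber_model_param]
  simp only [CStarMatrix.add_apply, mat_sum_apply, CStarMatrix.smul_apply,
    colUnit_mul_star_colUnit, unit_apply, EmbeddingLike.apply_eq_iff_eq, smul_eq_mul, mul_ite,
    mul_one, mul_zero, ite_and]
  simp

theorem kron_zero_left {ι κ : Type*} (b : Mat κ) : kron (0 : Mat ι) b = 0 := by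
  ext p q
  simp [kron_apply]

theorem kron_weight_zero (a : Mat (Fin n)) : kron a (weight n 0) = kron a 1 := by
  simp [weight]

theorem norm_kron_weight_le {a : Mat (Fin n)} {M : ℝ} (ha : ∀ i j, ‖a i j‖ ≤ M)
    (t : unitInterval) (p q : Fin n × Succ n) : ‖kron a (weight n t) p q‖ ≤ M := by
  have h1 : ‖weight n t p.2 q.2‖ ≤ 1 := by
    rw [weight_apply]
    have h0 := t.2.1
    have h1 := t.2.2
    split_ifs with h2 h3 h3
    · rw [← Complex.ofReal_one, ← Complex.ofReal_sub, Complex.norm_real, Real.norm_eq_abs,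
        abs_of_nonneg (by linarith)]
      linarith
    · simp
    · exact absurd (h3.1.trans h3.2.symm) h2
    · simp
  rw [kron_apply, norm_mul]
  have := ha p.1 q.1
  have h0 := norm_nonneg (a p.1 q.1)
  nlinarith [norm_nonneg (weight n t p.2 q.2)]

/-- Evaluation at `0` bounds the first parameter by `M`, evaluation at `1` then bounds the second by
`M + M`, and subtracting both contributions at a general `t` leaves `M + (M + 2 M) = 4 M` for the
third. The index `i₀` supplies a diagonal entry in which the second parameter is visible. -/
theorem norm_param_coeff_le (i₀ : Fin n) (p : Params n) {M : ℝ}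
    (hM : ‖(model hee he hh).param p‖ ≤ M) :
    (∀ i j, ‖p.1 i j‖ ≤ 4 * M) ∧ (∀ k l, ‖p.2.1 k l‖ ≤ 4 * M) ∧
    ∀ α β, ∀ t : unitInterval, ‖((X - X * X) * p.2.2 α β).eval ((t : ℝ) : ℂ)‖ ≤ 4 * M := by
  have hM0 : 0 ≤ M := (norm_nonneg _).trans hM
  have hentry : ∀ (t : unitInterval) (α β : Succ n × Fin n),
      ‖fiber t ((model hee he hh).param p) (swapIdx n α) (swapIdx n β)‖ ≤ M := fun t α β =>
    (CStarMatrix.norm_entry_le_norm).trans ((norm_fiber_le t _).trans hM)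
  have ha : ∀ i j, ‖p.1 i j‖ ≤ M := by
    intro i j
    have := hentry 0 (lastIdx n, i) (lastIdx n, j)
    rw [fiber_model_param_apply, kron_weight_zero] at this
    simpa [kron_apply, swapIdx] using this
  have hb : ∀ k l, ‖p.2.1 k l‖ ≤ 2 * M := by
    intro k l
    have h1 := hentry 1 (k, i₀) (l, i₀)
    have h2 := norm_kron_weight_le ha 1 (swapIdx n (k, i₀)) (swapIdx n (l, i₀))
    rw [fiber_model_param_apply] at h1
    simp only [if_true, Set.Icc.coe_one, Complex.ofReal_one, one_mul, eval_mul, eval_sub, eval_X,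
      sub_self, zero_mul, add_zero] at h1
    have h3 := norm_sub_le_of_le h1 h2
    rw [add_sub_cancel_left] at h3
    linarith
  refine ⟨fun i j => (ha i j).trans (by linarith), fun k l => (hb k l).trans (by linarith),
    fun α β t => ?_⟩
  have h1 := hentry t α β
  have h2 := norm_kron_weight_le ha t (swapIdx n α) (swapIdx n β)
  rw [fiber_model_param_apply] at h1
  have h3 : ‖(if α.2 = β.2 then ((t : ℝ) : ℂ) * p.2.1 α.1 β.1 else 0)‖ ≤ 2 * M := by
    split_ifs
    · rw [norm_mul, Complex.norm_real, Real.norm_eq_abs, abs_of_nonneg t.2.1]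
      have := hb α.1 β.1
      have h0 := norm_nonneg (p.2.1 α.1 β.1)
      nlinarith [t.2.1, t.2.2]
    · simpa using hM0
  have h4 := norm_sub_le_of_le h1 (norm_add_le_of_le h2 h3)
  rw [add_sub_cancel_left] at h4
  linarith

/-- The norm of an element of the `*`-algebra generated by any system of weighted units is
controlled by the norm of the corresponding element of the dimension drop algebra. -/
theorem exists_norm_param_le {B : Type*} [CStarAlgebra B] [PartialOrder B] [StarOrderedRing B]
    (i₀ : Fin n) (S : WeightedUnits n B) (hc : 0 ≤ S.ξ 1) :
    ∃ C : ℝ, ∀ p, ‖S.param p‖ ≤ C * ‖(model hee he hh).param p‖ := by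
  obtain ⟨C, hC⟩ := S.norm_param_le hc
  refine ⟨C * 4, fun p => ?_⟩
  obtain ⟨h1, h2, h3⟩ := norm_param_coeff_le hee he hh i₀ p le_rfl
  rw [mul_assoc]
  exact hC p _ h1 h2 h3

end Param

/-! ### Density of the parametrized elements -/

section Density

theorem exists_polynomial_near (g : C(unitInterval, ℂ)) {ε : ℝ} (hε : 0 < ε) :
    ∃ p : ℂ[X], ∀ t : unitInterval, ‖p.eval ((t : ℝ) : ℂ) - g t‖ ≤ ε := by
  obtain ⟨p, hp⟩ := exists_polynomial_near_continuousMap 0 1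
    ⟨fun t => (g t).re, by fun_prop⟩ (ε / 2) (by positivity)
  obtain ⟨q, hq⟩ := exists_polynomial_near_continuousMap 0 1
    ⟨fun t => (g t).im, by fun_prop⟩ (ε / 2) (by positivity)
  refine ⟨p.map (algebraMap ℝ ℂ) + C Complex.I * q.map (algebraMap ℝ ℂ), fun t => ?_⟩
  have h1 := (ContinuousMap.norm_coe_le_norm _ t).trans hp.le
  have h2 := (ContinuousMap.norm_coe_le_norm _ t).trans hq.le
  have e : (p.map (algebraMap ℝ ℂ) + C Complex.I * q.map (algebraMap ℝ ℂ)).eval ((t : ℝ) : ℂ) - g t =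
      ((p.eval (t : ℝ) - (g t).re : ℝ) : ℂ) + Complex.I * ((q.eval (t : ℝ) - (g t).im : ℝ) : ℂ) := by
    have hr : ∀ r : ℝ[X], (r.map (algebraMap ℝ ℂ)).eval ((t : ℝ) : ℂ) = ((r.eval (t : ℝ) : ℝ) : ℂ) :=
      fun r => by
        rw [eval_map_algebraMap]; exact aeval_algebraMap_apply ℂ (t : ℝ) r
    rw [eval_add, eval_mul, eval_C, hr, hr]
    conv_lhs => rw [← Complex.re_add_im (g t)]
    push_cast
    ring
  rw [e]
  refine (norm_add_le _ _).trans ?_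
  rw [norm_mul, Complex.norm_I, one_mul, Complex.norm_real, Complex.norm_real]
  have := add_le_add h1 h2
  rw [add_halves] at this
  exact this

/-- Polynomials that vanish at the end points are dense in `C_0((0, 1))`. -/
theorem exists_polynomial_near_of_vanish (g : C(unitInterval, ℂ)) (h0 : g 0 = 0) (h1 : g 1 = 0)
    {ε : ℝ} (hε : 0 < ε) :
    ∃ p : ℂ[X], ∀ t : unitInterval, ‖((X - X * X) * p).eval ((t : ℝ) : ℂ) - g t‖ ≤ ε := by
  obtain ⟨q, hq⟩ := exists_polynomial_near g (half_pos hε)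
  have hq0 := hq 0
  have hq1 := hq 1
  simp only [h0, h1, sub_zero, Set.Icc.coe_zero, Set.Icc.coe_one, Complex.ofReal_zero,
    Complex.ofReal_one] at hq0 hq1
  -- Subtracting the linear interpolation of the end values makes `r` vanish at `0` and `1`. As `g`
  -- vanishes there, those values are at most `ε / 2`, so the correction costs another `ε / 2`.
  set r := q - C (q.eval 0) * (1 - X) - C (q.eval 1) * X with hr
  have hdvd : X - X * X ∣ r := by
    obtain ⟨r₁, hr₁⟩ : X ∣ r := by
      rw [X_dvd_iff, coeff_zero_eq_eval_zero]
      simp [hr]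
    obtain ⟨r₂, hr₂⟩ : X - C 1 ∣ r₁ := by
      rw [dvd_iff_isRoot, IsRoot.def]
      have : r.eval 1 = 0 := by simp [hr]
      simpa [hr₁] using this
    exact ⟨-r₂, by rw [hr₁, hr₂, C_1]; ring⟩
  obtain ⟨p, hp⟩ := hdvd
  refine ⟨p, fun t => ?_⟩
  rw [← hp, hr]
  simp only [eval_sub, eval_mul, eval_C, eval_X, eval_one]
  have e : q.eval ((t : ℝ) : ℂ) - q.eval 0 * (1 - ((t : ℝ) : ℂ)) - q.eval 1 * ((t : ℝ) : ℂ) - g t =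
      (q.eval ((t : ℝ) : ℂ) - g t) - (q.eval 0 * ((1 - t : ℝ) : ℂ) + q.eval 1 * ((t : ℝ) : ℂ)) := by
    push_cast; ring
  rw [e]
  have ht0 := t.2.1
  have ht1 := t.2.2
  have h2 : ‖q.eval 0 * ((1 - t : ℝ) : ℂ) + q.eval 1 * ((t : ℝ) : ℂ)‖ ≤ ε / 2 := by
    refine (norm_add_le _ _).trans ?_
    rw [norm_mul, norm_mul, Complex.norm_real, Complex.norm_real, Real.norm_eq_abs,
      Real.norm_eq_abs, abs_of_nonneg ht0, abs_of_nonneg (by linarith : (0 : ℝ) ≤ 1 - t)]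
    nlinarith
  have := norm_sub_le_of_le (hq t) h2
  linarith

variable {n : ℕ} {e : Mat (Fin n)} {h : Fin n → ℂ} (hee : e * e = e)
  (he : ∀ i j, e i j = h i * star (h j)) (hh : ∑ i, star (h i) * h i = 1)

/-- In the indexing by `swapIdx`, the flip turns `1 ⊗ b` into `b ⊗ 1`, which is the form taken by
the span of the `H_{kl}` at `t = 1`. -/
theorem flip_apply_swapIdx (b : Mat (Succ n)) (α β : Succ n × Fin n) :
    (flip n * kron 1 b * flip n : Mat (Fin n × Succ n)) (swapIdx n α) (swapIdx n β) =
      if α.2 = β.2 then b α.1 β.1 else 0 := by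
  obtain ⟨i | i, j⟩ := α <;> obtain ⟨k | k, l⟩ := β <;>
    simp only [swapIdx, Equiv.coe_fn_mk, Sum.elim_inl, Sum.elim_inr] <;>
    rw [mul_flip, flip_mul] <;>
    simp [kron_apply, CStarMatrix.one_apply, Fin.fin_one_eq_zero]

theorem exists_params_vanish (f : dimDrop (Fin n) (Succ n)) : ∃ p : Params n,
    fiber 0 (f - (model hee he hh).param p) = 0 ∧ fiber 1 (f - (model hee he hh).param p) = 0 := by
  obtain ⟨f, ⟨a, ha⟩, b, hb⟩ := f
  -- The element `ξ(a)` already contributes `a ⊕ 0` at `t = 1`, so the second parameter supplies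
  -- only the difference.
  refine ⟨(a, fun k l => b k l - directSum a 0 k l, 0), ?_, ?_⟩
  · rw [map_sub, fiber_model_param, fiber_apply]
    simp only [flipPath_zero, ha, Set.Icc.coe_zero, kron_weight_zero]
    simp
  · rw [map_sub, fiber_apply]
    simp only [flipPath_one, hb, flip_star]
    ext p q
    obtain ⟨α, rfl⟩ := (swapIdx n).surjective p
    obtain ⟨β, rfl⟩ := (swapIdx n).surjective q
    rw [CStarMatrix.sub_apply, flip_apply_swapIdx, fiber_model_param_apply]
    obtain ⟨i | i, j⟩ := α <;> obtain ⟨k | k, l⟩ := β <;>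
      simp [kron_apply, swapIdx, weight_apply, directSum, Fin.fin_one_eq_zero]
    split_ifs <;> simp

/-- Once the boundary values are corrected, each matrix entry of the remainder lies in `C_0((0, 1))`
and is approximated by polynomials divisible by `t (1 - t)`, which is what the third parameter
provides. -/
theorem denseRange_model_param : DenseRange (model hee he hh).param := by
  intro f
  rw [Metric.mem_closure_iff]
  intro ε hε
  obtain ⟨p, h0, h1⟩ := exists_params_vanish hee he hh f
  set g := f - (model hee he hh).param p with hg
  set K : ℝ := ∑ α : Succ n × Fin n, ∑ β : Succ n × Fin n,
    ‖unit (swapIdx n α) (swapIdx n β)‖ with hK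
  have hK0 : 0 ≤ K := Finset.sum_nonneg fun _ _ => Finset.sum_nonneg fun _ _ => norm_nonneg _
  -- Summing the entrywise errors against the norms of the matrix units gives at most `ε / 2`; the
  -- `+ 1` keeps the denominator positive.
  have hδ : 0 < ε / (2 * (K + 1)) := by positivity
  have : ∀ α β : Succ n × Fin n, ∃ φ : ℂ[X], ∀ t : unitInterval,
      ‖((X - X * X) * φ).eval ((t : ℝ) : ℂ) - fiber t g (swapIdx n α) (swapIdx n β)‖ ≤
        ε / (2 * (K + 1)) := fun α β =>
    exists_polynomial_near_of_vanish ⟨fun t => fiber t g (swapIdx n α) (swapIdx n β),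
      (continuous_entry _ _).comp (continuous_fiber g)⟩ (by simp [h0]) (by simp [h1]) hδ
  choose φ hφ using this
  refine ⟨_, ⟨p + (0, 0, φ), rfl⟩, ?_⟩
  rw [dist_eq_norm, map_add, ← sub_sub, ← hg]
  refine lt_of_le_of_lt (norm_le_of_forall_fiber (C := ε / 2) (by positivity) fun t => ?_)
    (half_lt_self hε)
  have e : fiber t (g - (model hee he hh).param (0, 0, φ)) = ∑ α, ∑ β,
      (fiber t g (swapIdx n α) (swapIdx n β) - ((X - X * X) * φ α β).eval ((t : ℝ) : ℂ)) •
        unit (swapIdx n α) (swapIdx n β) := by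
    rw [map_sub, fiber_model_param]
    simp only [sub_smul, Finset.sum_sub_distrib]
    congr 1
    · conv_lhs => rw [eq_sum_unit (fiber t g), ← (swapIdx n).sum_comp]
      refine Finset.sum_congr rfl fun α _ => ?_
      rw [← (swapIdx n).sum_comp]
    · simp [kron_zero_left]
  rw [e]
  calc _ ≤ ∑ α : Succ n × Fin n, ∑ β : Succ n × Fin n,
        ε / (2 * (K + 1)) * ‖unit (swapIdx n α) (swapIdx n β)‖ := by
        refine norm_sum_le_of_le _ fun α _ => norm_sum_le_of_le _ fun β _ => ?_
        rw [norm_smul, norm_sub_rev]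
        exact mul_le_mul_of_nonneg_right (hφ α β t) (norm_nonneg _)
    _ = ε / (2 * (K + 1)) * K := by simp only [← Finset.mul_sum, hK]
    _ ≤ ε / 2 := by
        rw [div_mul_eq_mul_div, div_le_div_iff₀ (by positivity) (by positivity)]
        nlinarith

end Density

/-! ### Rank-one projections as `h h^*` -/

section RankOne

variable {n : ℕ}

/-- All columns are multiples of one vector `v`, so self-adjointness forces `e = κ v v^*`.
Idempotence gives `κ ‖v‖² = 1`; thus `κ > 0` and `h = √κ v` works. -/
theorem exists_vector_of_rank_one {e : Mat (Fin n)} (he : IsStarProjection e)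
    (hr : (CStarMatrix.ofMatrix.symm e).rank = 1) :
    ∃ h : Fin n → ℂ, (∀ i j, e i j = h i * star (h j)) ∧ ∑ i, star (h i) * h i = 1 := by
  obtain ⟨⟨v, hv⟩, hv0, hspan⟩ := finrank_eq_one_iff'.mp hr
  have hv0' : v ≠ 0 := fun h => hv0 (Subtype.ext h)
  obtain ⟨i₀, hi₀⟩ := Function.ne_iff.mp hv0'
  have hc : ∀ j, ∃ c : ℂ, ∀ i, e i j = c * v i := by
    intro j
    obtain ⟨c, hc⟩ := hspan ⟨_, LinearMap.mem_range_self _ (Pi.single j (1 : ℂ))⟩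
    refine ⟨c, fun i => ?_⟩
    have := congrFun (congrArg Subtype.val hc) i
    simp only [Matrix.mulVecLin_apply, Matrix.mulVec_single_one] at this
    exact this.symm
  choose c hc using hc
  have hstar : ∀ i j, e i j = star (e j i) := by
    intro i j
    conv_lhs => rw [← he.isSelfAdjoint.star_eq, CStarMatrix.star_apply]
  set κ : ℂ := star (c i₀) / v i₀ with hκ
  have hei : ∀ i j, e i j = κ * (v i * star (v j)) := by
    intro i j
    have h1 : c j * v i₀ = star (c i₀) * star (v j) := by
      rw [← hc, hstar, hc, star_mul']
    have h2 : c j = κ * star (v j) := by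
      rw [hκ, div_mul_eq_mul_div, ← h1, mul_div_cancel_right₀ _ hi₀]
    rw [hc, h2]
    ring
  have hmul : ∀ i j, e i j = ∑ k, e i k * e k j := by
    intro i j
    rw [← CStarMatrix.mul_apply, he.isIdempotentElem.eq]
  set N : ℂ := ∑ k, star (v k) * v k with hN
  have hκN : κ * N = 1 := by
    have h1 := hmul i₀ i₀
    have h2 : ∑ k, e i₀ k * e k i₀ = κ * N * (κ * (v i₀ * star (v i₀))) := by
      rw [hN, Finset.mul_sum, Finset.sum_mul]
      refine Finset.sum_congr rfl fun k _ => ?_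
      rw [hei, hei]
      ring
    rw [h2, hei] at h1
    have hne : κ * (v i₀ * star (v i₀)) ≠ 0 := by
      intro h0
      have hκ0 : κ = 0 := by
        rcases mul_eq_zero.mp h0 with h | h
        · exact h
        · rcases mul_eq_zero.mp h with h | h
          · exact absurd h hi₀
          · exact absurd (star_eq_zero.mp h) hi₀
      have he0 : CStarMatrix.ofMatrix.symm e = 0 := by
        ext i j
        rw [CStarMatrix.ofMatrix_symm_apply, hei, hκ0, zero_mul]
        rfl
      rw [he0, Matrix.rank_zero] at hr
      exact zero_ne_one hr
    exact (mul_right_cancel₀ hne (h1.symm.trans (one_mul _).symm))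
  have hNr : N = ((∑ k, ‖v k‖ ^ 2 : ℝ) : ℂ) := by
    rw [hN]
    push_cast
    exact Finset.sum_congr rfl fun k _ => Complex.conj_mul' (v k)
  set R : ℝ := ∑ k, ‖v k‖ ^ 2 with hR
  have hR0 : 0 ≤ R := Finset.sum_nonneg fun _ _ => by positivity
  have hκR : κ = ((R⁻¹ : ℝ) : ℂ) := by
    rw [Complex.ofReal_inv, ← hNr]
    exact eq_inv_of_mul_eq_one_left hκN
  have hsq : ((Real.sqrt R⁻¹ : ℝ) : ℂ) * ((Real.sqrt R⁻¹ : ℝ) : ℂ) = κ := by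
    rw [hκR, ← Complex.ofReal_mul, Real.mul_self_sqrt (inv_nonneg.mpr hR0)]
  refine ⟨fun i => ((Real.sqrt R⁻¹ : ℝ) : ℂ) * v i, fun i j => ?_, ?_⟩
  · rw [hei, ← hsq, star_mul', Complex.star_def, Complex.conj_ofReal]
    ring
  · rw [← hκN, ← hsq, hN, Finset.mul_sum]
    refine Finset.sum_congr rfl fun k _ => ?_
    rw [star_mul', Complex.star_def, Complex.conj_ofReal]
    ring

end RankOne

/-! ### Extension by continuity to the whole dimension drop algebra -/

section Extension

variable {n : ℕ} {e : Mat (Fin n)} {h : Fin n → ℂ} (hee : e * e = e)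
  (he : ∀ i j, e i j = h i * star (h j)) (hh : ∑ i, star (h i) * h i = 1)

theorem norm_star_dimDrop {ι κ : Type*} [Fintype ι] [DecidableEq ι] [Fintype κ] [DecidableEq κ]
    (f : dimDrop ι κ) : ‖star f‖ = ‖f‖ :=
  norm_star (f : C(unitInterval, Mat (ι × κ)))

theorem continuous_star_dimDrop {ι κ : Type*} [Fintype ι] [DecidableEq ι] [Fintype κ]
    [DecidableEq κ] : Continuous (star : dimDrop ι κ → dimDrop ι κ) := by
  refine (Isometry.of_dist_eq fun f g => ?_).continuous
  rw [dist_eq_norm, dist_eq_norm, ← star_sub, norm_star_dimDrop]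

/-- The universal property of the dimension drop algebra: every system of weighted units is the
image of the canonical one under a unital homomorphism. -/
theorem exists_hom_of_weightedUnits {B : Type*} [CStarAlgebra B] [PartialOrder B]
    [StarOrderedRing B] (i₀ : Fin n) (S : WeightedUnits n B) (hc : 0 ≤ S.ξ 1) :
    ∃ π : dimDrop (Fin n) (Succ n) →⋆ₐ[ℂ] B, Continuous π ∧
      ∀ p, π ((model hee he hh).param p) = S.param p := by
  have hd := denseRange_model_param hee he hh
  have hC := exists_norm_param_le hee he hh i₀ S hc
  set L := S.param.extendOfNorm (model hee he hh).param with hLdef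
  have hL : ∀ p, L ((model hee he hh).param p) = S.param p := fun p =>
    LinearMap.extendOfNorm_eq hd hC p
  have hone : L 1 = 1 := by
    obtain ⟨r, h1, h2⟩ := (model hee he hh).exists_param_one S
    rw [← h1, hL, h2]
  have hmul : ∀ x y, L (x * y) = L x * L y := by
    intro x y
    refine hd.induction_on₂ (p := fun x y => L (x * y) = L x * L y) ?_ ?_ x y
    · exact isClosed_eq (by fun_prop) (by fun_prop)
    · intro p q
      obtain ⟨r, h1, h2⟩ := (model hee he hh).exists_param_mul S p q
      rw [← h1, hL, hL, hL, h2]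
  have hstar : ∀ x, L (star x) = star (L x) := by
    intro x
    refine hd.induction_on (p := fun x => L (star x) = star (L x)) x ?_ ?_
    · exact isClosed_eq (L.continuous.comp continuous_star_dimDrop)
        (continuous_star.comp L.continuous)
    · intro p
      obtain ⟨r, h1, h2⟩ := (model hee he hh).exists_param_star S p
      rw [← h1, hL, hL, h2]
  exact ⟨{ toFun := L
           map_one' := hone
           map_mul' := hmul
           map_zero' := map_zero L
           map_add' := map_add L
           commutes' := fun c => by
            rw [Algebra.algebraMap_eq_smul_one, Algebra.algebraMap_eq_smul_one, map_smul, hone]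
           map_star' := hstar }, L.continuous, hL⟩

end Extension

/-! ### The group action on the model -/

section Equivariance

variable {n : ℕ} {G : Type*} [Group G] (v : G →* unitary (Mat (Fin n)))

theorem flip_mul_kron_comm (w : Mat (Fin n)) :
    flip n * kron w (directSum w 1) = kron w (directSum w 1) * flip n := by
  ext ⟨i, j⟩ ⟨k, l⟩
  rw [flip_mul, mul_flip]
  rcases j with j | j <;> rcases l with l | l <;>
    simp [kron_apply, directSum, mul_comm, Fin.fin_one_eq_zero]

theorem flipPath_mul_kron_comm (w : Mat (Fin n)) (t : unitInterval) :
    flipPath n t * kron w (directSum w 1) = kron w (directSum w 1) * flipPath n t := by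
  simp only [flipPath, add_mul, mul_add, smul_mul_assoc, mul_smul_comm, one_mul, mul_one,
    flip_mul_kron_comm]

/-- The path `u_t` lies in the span of `1` and the flip, both of which commute with `v_g ⊗ (v_g ⊕
1)`. Removing the conjugation by `u_t` therefore does not affect the action. -/
theorem fiber_dimDropAction (g : G) (f : dimDrop (Fin n) (Succ n)) (t : unitInterval) :
    fiber t (dimDropAction v (sumRep v 1) g f) = Ad (tensorRep v (sumRep v 1)) g (fiber t f) := by
  have hN : ((tensorRep v (sumRep v 1) g : unitary (Mat (Fin n × Succ n))) :
      Mat (Fin n × Succ n)) = kron (v g : Mat (Fin n)) (directSum (v g : Mat (Fin n)) 1) := rfl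
  have h1 := flipPath_mul_kron_comm (v g : Mat (Fin n)) t
  have h2 := congrArg star (flipPath_mul_kron_comm (v g : Mat (Fin n)) t)
  rw [star_mul, star_mul] at h2
  rw [fiber_apply, fiber_apply, Ad_apply, hN]
  change flipPath n t * (Ad (tensorRep v (sumRep v 1)) g
    ((f : C(unitInterval, Mat (Fin n × Succ n))) t)) * _ = _
  rw [Ad_apply, hN, ← mul_assoc, ← mul_assoc, h1]
  simp only [mul_assoc]
  rw [h2]

theorem Ad_sumRep_lastProj (g : G) :
    Ad (sumRep v (1 : G →* unitary (Mat (Fin 1)))) g (lastProj n) = lastProj n := by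
  have hN : ((sumRep v (1 : G →* unitary (Mat (Fin 1))) g : unitary (Mat (Succ n))) :
      Mat (Succ n)) = directSum (v g : Mat (Fin n)) 1 := rfl
  rw [Ad_apply, hN, lastProj, directSum_star, directSum_mul, directSum_mul]
  simp

theorem dimDropAction_embed (g : G) (x : Mat (Fin n)) :
    dimDropAction v (sumRep v 1) g (embed x) = embed (Ad v g x) :=
  fiber_ext fun t => by
    rw [fiber_dimDropAction, fiber_embed, fiber_embed, Ad_tensorRep, weight, map_sub, map_one,
      map_smul, Ad_sumRep_lastProj]

theorem dimDropAction_absCorner (g : G) :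
    dimDropAction v (sumRep v 1) g (absCorner n) = absCorner n :=
  fiber_ext fun t => by
    rw [fiber_dimDropAction, fiber_absCorner, map_smul, Ad_tensorRep, map_one, Ad_sumRep_lastProj]

theorem kron_directSum_mul_cornerMat {w : Mat (Fin n)} {h : Fin n → ℂ}
    (hw : ∀ i, ∑ j, w i j * h j = h i) :
    kron w (directSum w 1) * cornerMat h = cornerMat h * kron w (directSum w 1) := by
  ext ⟨i, j⟩ ⟨k, l⟩
  rw [CStarMatrix.mul_apply, CStarMatrix.mul_apply, Fintype.sum_prod_type, Fintype.sum_prod_type]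
  simp only [kron_apply, cornerMat_apply]
  rcases j with j | j <;> rcases l with l | l <;>
    simp [directSum, ite_and, Fin.fin_one_eq_zero]
  rw [← hw i, Finset.sum_mul]
  exact Finset.sum_congr rfl fun x _ => by ring

theorem dimDropAction_corner {h : Fin n → ℂ} (g : G)
    (hv : ∀ i, ∑ j, (v g : Mat (Fin n)) i j * h j = h i) :
    dimDropAction v (sumRep v 1) g (corner h) = corner h :=
  fiber_ext fun t => by
    have hN : ((tensorRep v (sumRep v 1) g : unitary (Mat (Fin n × Succ n))) :
      Mat (Fin n × Succ n)) = kron (v g : Mat (Fin n)) (directSum (v g : Mat (Fin n)) 1) := rfl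
    rw [fiber_dimDropAction, fiber_corner, map_smul, Ad_apply, hN, kron_directSum_mul_cornerMat hv,
      ← hN, mul_assoc]
    rw [Unitary.mul_star_self_of_mem (tensorRep v (sumRep v 1) g).2, mul_one]

theorem continuous_dimDropAction (g : G) :
    Continuous (dimDropAction v (sumRep v (1 : G →* unitary (Mat (Fin 1)))) g) := by
  refine Continuous.subtype_mk (f := fun f : dimDrop (Fin n) (Succ n) =>
    ContinuousMap.const unitInterval
        ((tensorRep v (sumRep v 1) g : unitary (Mat (Fin n × Succ n))) : Mat (Fin n × Succ n)) *
      (f : C(unitInterval, Mat (Fin n × Succ n))) *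
      ContinuousMap.const unitInterval
        (star ((tensorRep v (sumRep v 1) g : unitary (Mat (Fin n × Succ n))) :
          Mat (Fin n × Succ n)))) (by fun_prop) _

end Equivariance

/-! ### Recovering `s` and assembling the equivariant homomorphism -/

section Main

variable {n : ℕ} {e : Mat (Fin n)} {h : Fin n → ℂ} (hee : e * e = e)
  (he : ∀ i j, e i j = h i * star (h j)) (hh : ∑ i, star (h i) * h i = 1)

theorem model_ξ (a : Mat (Fin n)) : (model hee he hh).ξ a = embed a := rfl

theorem model_Y_inl (i : Fin n) :
    (model hee he hh).Y (Sum.inl i) = embed (colMat h i) * corner h := rfl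

theorem model_Y_last : (model hee he hh).Y (lastIdx n) = absCorner n := rfl

variable {B : Type*} [CStarAlgebra B]

/-- Two continuous unital homomorphisms on the dimension drop algebra that agree with the same
system of weighted units are equal. -/
theorem hom_ext_of_weightedUnits {π ψ : dimDrop (Fin n) (Succ n) →⋆ₐ[ℂ] B} (hπ : Continuous π)
    (hψ : Continuous ψ) {S : WeightedUnits n B}
    (h1 : ∀ p, π ((model hee he hh).param p) = S.param p) (h2 : ∀ x, ψ (embed x) = S.ξ x)
    (h3 : ∀ k, ψ ((model hee he hh).Y k) = S.Y k) (f : dimDrop (Fin n) (Succ n)) :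
    ψ f = π f := by
  refine congrFun ((denseRange_model_param hee he hh).equalizer hψ hπ ?_) f
  funext p
  exact (WeightedUnits.map_param _ S ψ h2 h3 p).trans (h1 p).symm

variable {S : WeightedUnits n B} {π : dimDrop (Fin n) (Succ n) →⋆ₐ[ℂ] B}

theorem map_embed_of_param (hee : e * e = e) (he : ∀ i j, e i j = h i * star (h j)) (hh : ∑ i, star (h i) * h i = 1)
    (hπ : ∀ p, π ((model hee he hh).param p) = S.param p)
    (x : Mat (Fin n)) : π (embed x) = S.ξ x := by
  rw [← S.param_mat, ← hπ, WeightedUnits.param_mat, model_ξ]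

theorem map_H_of_param (hee : e * e = e) (he : ∀ i j, e i j = h i * star (h j)) (hh : ∑ i, star (h i) * h i = 1)
    (hπ : ∀ p, π ((model hee he hh).param p) = S.param p)
    (k l : Succ n) : π ((model hee he hh).H k l) = S.H k l := by
  rw [← S.param_matrixUnit, ← hπ, WeightedUnits.param_matrixUnit]

variable [PartialOrder B] [StarOrderedRing B]

/-- A completely positive order zero map `ξ` and an element `s` with `ξ(e) s = s` and
`ξ(1) + s^* s = 1` give rise to a system of weighted units. -/
theorem exists_weightedUnits (ξ : CompletelyPositiveMap (Mat (Fin n)) B) (hξ : IsOrderZero ξ)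
    (hee : e * e = e) (he : ∀ i j, e i j = h i * star (h j)) {s : B} (hs : ξ e * s = s)
    (hsum : ξ 1 + star s * s = 1) :
    ∃ S : WeightedUnits n B, (∀ a, S.ξ a = ξ a) ∧ (∀ i, S.Y (Sum.inl i) = ξ (colMat h i) * s) ∧
      S.Y (lastIdx n) = CFC.sqrt (star s * s) := by
  set d := CFC.sqrt (star s * s) with hd
  have hdd : d * d = star s * s := CFC.sqrt_mul_sqrt_self _ (star_mul_self_nonneg s)
  have hdsa : star d = d := (IsSelfAdjoint.of_nonneg (CFC.sqrt_nonneg _)).star_eq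
  have hss1 : star s * s = 1 - ξ 1 := by rw [← hsum]; abel
  have hcs : ξ 1 * s = s := by
    conv_lhs => rw [← hs, ← mul_assoc]
    rw [← hee, ← hξ.map_mul_map, mul_assoc, hs, hs]
  have hcomm : ∀ a, ξ a * d = d * ξ a := by
    intro a
    have : Commute (star s * s) (ξ a) := by
      rw [hss1]
      refine (Commute.one_left _).sub_left ?_
      change ξ 1 * ξ a = ξ a * ξ 1
      rw [hξ.map_mul_map a 1, mul_one]
    rw [hd, CFC.sqrt_eq_cfc]
    exact (this.cfc_nnreal _).symm
  -- `(d s)^* (d s) = s^* (1 - ξ(1)) s = 0`, since `ξ(1) s = s`.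
  have hds : d * s = 0 := by
    rw [← CStarRing.star_mul_self_eq_zero_iff, star_mul, hdsa, mul_assoc, ← mul_assoc d, hdd, hss1,
      sub_mul, one_mul, hcs, sub_self, mul_zero]
  exact ⟨WeightedUnits.ofCorner ξ.toLinearMap
    (fun a => (completelyPositive_map_star ξ a).symm) hξ.map_mul_map hee he hs hsum
    hdsa hdd hcomm hds, fun _ => rfl, fun _ => rfl, rfl⟩

/-- A unital homomorphism on the dimension drop algebra that is compatible with weighted units
maps `|s_h|` to the last weighted unit. -/
theorem map_absCorner_of_param (hee : e * e = e) (he : ∀ i j, e i j = h i * star (h j)) (hh : ∑ i, star (h i) * h i = 1)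
    (hπ : ∀ p, π ((model hee he hh).param p) = S.param p)
    (hlast : 0 ≤ S.Y (lastIdx n)) :
    π (absCorner n) = S.Y (lastIdx n) := by
  have h1 : π (absCorner n) * π (absCorner n) = S.Y (lastIdx n) * S.Y (lastIdx n) := by
    have := map_H_of_param hee he hh hπ (lastIdx n) (lastIdx n)
    rwa [WeightedUnits.H, WeightedUnits.H, S.star_last, model_Y_last, star_absCorner,
      map_mul] at this
  have h2 : 0 ≤ π (absCorner n) := by
    obtain ⟨r, hr⟩ := exists_absCorner_eq n
    rw [hr, map_mul, map_star]
    exact star_mul_self_nonneg _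
  rw [← CFC.sqrt_unique h1 h2, CFC.sqrt_mul_self _ hlast]

/-- The element `s_h |s_h| = ∑ h_i H_{i,n+1}` is parametrized, which gives `π(s_h) |s| = s |s|`.
Together with `π(s_h)^* π(s_h) = s^* s` this determines `π(s_h)`, although `|s|` need not be
invertible. -/
theorem map_corner_of_param (hee : e * e = e) (he : ∀ i j, e i j = h i * star (h j)) (hh : ∑ i, star (h i) * h i = 1)
    (hπ : ∀ p, π ((model hee he hh).param p) = S.param p)
    (hlast : 0 ≤ S.Y (lastIdx n)) {s : B}
    (hY : ∀ i, S.Y (Sum.inl i) = S.ξ (colMat h i) * s) (hs : S.ξ e * s = s)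
    (hss : star s * s = S.Y (lastIdx n) * S.Y (lastIdx n)) : π (corner h) = s := by
  have hd := map_absCorner_of_param hee he hh hπ hlast
  have hsd : π (corner h) * S.Y (lastIdx n) = s * S.Y (lastIdx n) := by
    have h1 : ∑ i, h i • (model hee he hh).H (Sum.inl i) (lastIdx n) = corner h * absCorner n := by
      simp only [WeightedUnits.H, model_Y_last, model_Y_inl, star_absCorner, ← model_ξ hee he hh,
        ← smul_mul_assoc, ← map_smul, ← Finset.sum_mul, ← map_sum, sum_smul_colMat he]
      rw [model_ξ, embed_mul_corner he hh]
    have h2 : ∑ i, h i • S.H (Sum.inl i) (lastIdx n) = s * S.Y (lastIdx n) := by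
      simp only [WeightedUnits.H, hY, S.star_last, ← smul_mul_assoc, ← map_smul, ← Finset.sum_mul,
        ← map_sum, sum_smul_colMat he, hs]
    rw [← h2, ← hd, ← map_mul, ← h1, map_sum]
    simp only [map_smul, map_H_of_param hee he hh hπ]
  set s' := π (corner h) with hs'
  have hs's' : star s' * s' = star s * s := by
    rw [hs', ← map_star, ← map_mul, star_corner_mul_corner hh, map_mul, hd, hss]
  have hx : (s' - s) * (star s * s) = 0 := by
    rw [hss, ← mul_assoc, sub_mul, hsd, sub_self, zero_mul]
  -- Here `(s' - s) y^*` times its adjoint is `(s' - s) s^* s (s' - s)^*`, which vanishes by `hx`.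
  -- The cases `y = s'` and `y = s` combine to `(s' - s)(s' - s)^* = 0`.
  have key : ∀ y : B, star y * y = star s * s → (s' - s) * star y = 0 := by
    intro y hy
    rw [← CStarRing.mul_star_self_eq_zero_iff, star_mul, star_star, mul_assoc, ← mul_assoc _ y, hy,
      ← mul_assoc, hx, zero_mul]
  have : (s' - s) * star (s' - s) = 0 := by
    rw [star_sub, mul_sub, key s' hs's', key s rfl, sub_zero]
  exact sub_eq_zero.mp (CStarRing.mul_star_self_eq_zero_iff _ |>.mp this)

end Main

/-- A completely positive equivariant order zero map together with a compatible fixed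
element extends to an equivariant homomorphism on the dimension drop algebra. -/
theorem exists_equivariant_hom {G : Type*} [Group G]
    {B : Type*} [CStarAlgebra B] [PartialOrder B] [StarOrderedRing B]
    (β : G →* (B ≃⋆ₐ[ℂ] B)) (n : ℕ)
    (v : G →* unitary (Mat (Fin n)))
    (e : Mat (Fin n)) (he : IsStarProjection e)
    (he_rank : (CStarMatrix.ofMatrix.symm e).rank = 1)
    (he_fix : ∀ g, (v g : Mat (Fin n)) * e = e)
    (ξ : CompletelyPositiveMap (Mat (Fin n)) B)
    (hξ_zero : IsOrderZero ξ)
    (hξ_equiv : ∀ g x, ξ (Ad v g x) = β g (ξ x))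
    (s : B) (hs_fix : ∀ g, β g s = s)
    (hs_left : ξ e * s = s) (hs_sum : ξ 1 + star s * s = 1) :
    ∃ π : dimDrop (Fin n) (Succ n) →⋆ₐ[ℂ] B,
      (∀ g f, π (dimDropAction v (sumRep v 1) g f) = β g (π f)) ∧
      (∀ x, π (embed x) = ξ x) ∧
      ∃ h : Fin n → ℂ, (∀ i j, e i j = h i * star (h j)) ∧ π (corner h) = s := by
  obtain ⟨h, heh, hh⟩ := exists_vector_of_rank_one he he_rank
  have hee : e * e = e := he.isIdempotentElem
  obtain ⟨i₀, hi₀⟩ : ∃ i, h i ≠ 0 := by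
    by_contra! h0
    simp [h0] at hh
  obtain ⟨S, hSξ, hSY, hSlast⟩ := exists_weightedUnits ξ hξ_zero hee heh hs_left hs_sum
  have hlast : 0 ≤ S.Y (lastIdx n) := hSlast ▸ CFC.sqrt_nonneg _
  have hss : star s * s = S.Y (lastIdx n) * S.Y (lastIdx n) := by
    rw [hSlast, CFC.sqrt_mul_sqrt_self _ (star_mul_self_nonneg s)]
  obtain ⟨π, hπc, hπ⟩ := exists_hom_of_weightedUnits hee heh hh i₀ S
    (hSξ 1 ▸ map_nonneg ξ zero_le_one)
  have hπξ : ∀ x, π (embed x) = ξ x := fun x =>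
    (map_embed_of_param hee heh hh hπ x).trans (hSξ x)
  have hπd := map_absCorner_of_param hee heh hh hπ hlast
  have hπs : π (corner h) = s := map_corner_of_param hee heh hh hπ hlast
    (fun i => by rw [hSY, hSξ]) (by rw [hSξ, hs_left]) hss
  -- Column `i₀` of `v_g h h^* = h h^*` is `v_g h = h` up to the nonzero factor `star (h i₀)`.
  have hvh : ∀ g i, ∑ j, (v g : Mat (Fin n)) i j * h j = h i := by
    intro g i
    have h1 := congrArg (fun m : Mat (Fin n) => m i i₀) (he_fix g)
    simp only [CStarMatrix.mul_apply, heh, ← mul_assoc, ← Finset.sum_mul] at h1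
    exact mul_right_cancel₀ (star_ne_zero.mpr hi₀) h1
  refine ⟨π, fun g f => ?_, hπξ, h, heh, hπs⟩
  have hinv : ∀ x, β g⁻¹ (β g x) = x := fun x => by
    rw [← StarAlgEquiv.mul_apply, ← map_mul, inv_mul_cancel, map_one, StarAlgEquiv.one_apply]
  have hinv' : ∀ x, β g (β g⁻¹ x) = x := fun x => by
    rw [← StarAlgEquiv.mul_apply, ← map_mul, mul_inv_cancel, map_one, StarAlgEquiv.one_apply]
  -- Equivariance at `g` amounts to `ψ = π`, and both are continuous, so agreement on the weighted
  -- units suffices.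
  let ψ : dimDrop (Fin n) (Succ n) →⋆ₐ[ℂ] B :=
    ((β g⁻¹ : B ≃⋆ₐ[ℂ] B) : B →⋆ₐ[ℂ] B).comp
      (π.comp ((dimDropAction v (sumRep v 1) g : dimDrop (Fin n) (Succ n) ≃⋆ₐ[ℂ] _) :
        dimDrop (Fin n) (Succ n) →⋆ₐ[ℂ] dimDrop (Fin n) (Succ n)))
  have hψ : ∀ f, ψ f = β g⁻¹ (π (dimDropAction v (sumRep v 1) g f)) := fun _ => rfl
  have hψξ : ∀ x, ψ (embed x) = ξ x := fun x => by
    rw [hψ, dimDropAction_embed, hπξ, hξ_equiv, hinv]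
  have hψd : ψ (absCorner n) = S.Y (lastIdx n) := by
    rw [hψ, dimDropAction_absCorner, hπd]
    -- The automorphism fixes `s`, hence also `|s|`, the unique positive square root of `s^* s`.
    have h1 : β g⁻¹ (S.Y (lastIdx n)) * β g⁻¹ (S.Y (lastIdx n)) = star s * s := by
      rw [← map_mul, ← hss, map_mul, map_star, hs_fix]
    have h2 : 0 ≤ β g⁻¹ (S.Y (lastIdx n)) := by
      obtain ⟨r, hr⟩ := exists_eq_star_mul_self hlast
      rw [hr, map_mul, map_star]
      exact star_mul_self_nonneg _
    rw [← CFC.sqrt_unique h1 h2, hSlast]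
  have hψπ := hom_ext_of_weightedUnits hee heh hh hπc (ψ := ψ)
    ((map_continuous (β g⁻¹)).comp (hπc.comp (continuous_dimDropAction v g))) hπ
    (fun x => (hψξ x).trans (hSξ x).symm) (by
      intro k
      obtain ⟨i, rfl⟩ | rfl := WeightedUnits.eq_inl_or_eq_last k
      · rw [model_Y_inl, map_mul, hψξ, hψ (corner h), dimDropAction_corner v g (hvh g), hπs,
          hs_fix, hSY]
      · exact hψd) f
  rw [← hψπ, hψ, hinv']

end DimDrop

theorem mainTheorem8 {G : Type*} [Group G] [Finite G]
    {B : Type*} [CStarAlgebra B] [PartialOrder B] [StarOrderedRing B]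
    (β : G →* (B ≃⋆ₐ[ℂ] B)) (n : ℕ)
    (v : G →* unitary (DimDrop.Mat (Fin n)))
    (e : DimDrop.Mat (Fin n)) (he : IsStarProjection e)
    (he_rank : (CStarMatrix.ofMatrix.symm e).rank = 1)
    (he_fix : ∀ g, (v g : DimDrop.Mat (Fin n)) * e = e)
    (ξ : CompletelyPositiveMap (DimDrop.Mat (Fin n)) B)
    (hξ_contr : ∀ x, ‖ξ x‖ ≤ ‖x‖)
    (hξ_zero : DimDrop.IsOrderZero ξ)
    (hξ_equiv : ∀ g x, ξ (DimDrop.Ad v g x) = β g (ξ x))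
    (s : B) (hs_contr : ‖s‖ ≤ 1) (hs_fix : ∀ g, β g s = s)
    (hs_left : ξ e * s = s) (hs_sum : ξ 1 + star s * s = 1) :
    ∃ π : DimDrop.dimDrop (Fin n) (DimDrop.Succ n) →⋆ₐ[ℂ] B,
      (∀ g f, π (DimDrop.dimDropAction v (DimDrop.sumRep v 1) g f) = β g (π f)) ∧
      (∀ x, π (DimDrop.embed x) = ξ x) ∧
      ∃ h : Fin n → ℂ, (∀ i j, e i j = h i * star (h j)) ∧ π (DimDrop.corner h) = s :=
  DimDrop.exists_equivariant_hom β n v e he he_rank he_fix ξ hξ_zero hξ_equiv s hs_fix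
    hs_left hs_sum
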